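/- Let $\Omega=(0,1)$, $T>0$, $\alpha_0>0$, $\alpha_1,\alpha_2\in\mathbb R$, and let $$\mathcal D=\{d\in H^1(\Omega):\ \alpha_0\le d(x)\le\alpha_1 \text{ for all } x\in\Omega,\ \|d\|_{H^1(\Omega)}\le\alpha_2\},$$ with the metric of $H^1(\Omega)$. Let $V_0^2(\Omega)=\{z\in H^2(\Omega): z=0 \text{ on } \partial\Omega\}$, and let $u_0\in H^2(\Omega)$, $v_0\in H^1_0(\Omega)$. For $d\in\mathcal D$ consider the cascade system $$u_t+u_{xxxx}=v,\qquad v_t-(d(x)v_x)_x=0\quad\text{in }\Omega\times(0,T),$$ $$u(\cdot,0)=u_0,\quad v(\cdot,0)=v_0\ \text{ in }\Omega,\qquad u=u_{xx}=0,\ v=0\ \text{ on }\partial\Omega\times(0,T).$$ A weak solution is a pair $(u,v)\in L^2(0,T;V_0^2(\Omega))\times L^2(0,T;H_0^1(\Omega))$ with $(u_t,v_t)\in L^2(0,T;V_0^2(\Omega)^*)\times L^2(0,T;H^{-1}(\Omega))$, identified with its representative in $C([0,T];L^2(\Omega))^2$, such that $u(0)=u_0$, $v(0)=v_0$ and, for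 a.e. $t\in(0,T)$ and all $\phi\in V_0^2(\Omega)$, $$\langle u_t,\phi\rangle+(u_{xx},\phi_{xx})=(v,\phi),\qquad \langle v_t,\phi\rangle+(d\,v_x,\phi_x)=0 .$$ Then for every $d\in\mathcal D$ there is exactly one weak solution $(u(\cdot,\cdot;d),v(\cdot,\cdot;d))$, and $(u(\cdot,T;d),v(\cdot,T;d))\in H^1_0(\Omega)\times L^2(\Omega)$. The input-output operator $$\Psi:\mathcal D\to H_0^1(\Omega)\times L^2(\Omega),\qquad \Psi[d]=(u(\cdot,T;d),v(\cdot,T;d)),$$ maps bounded subsets of $\mathcal D$ to bounded subsets of $H^1_0(\Omega)\times L^2(\Omega)$, and, regarded as an operator into $L^2(\Omega)\times L^2(\Omega)$, it is compact: it is continuous and maps bounded subsets of $\mathcal D$ to relatively compact sets. Consequently the inverse problem of recovering $d$ from $\Psi[d]$ is ill-posed: if $\alpha_0<\alpha_1$ and $\alpha_0<\alpha_2$ (that is, if $\mathcal D$ has more than one element), there are $d\in\mathcal D$ and a sequence $(d_n)$ in $\mathcal D$ with $\Psi[d_n]\to\Psi[d]$ in $L^2(\Omega)\times L^2(\Omega)$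 while $(d_n)$ does not converge to $d$ in $H^1(\Omega)$. -/

import Mathlib

open MeasureTheory Set Filter Topology
open scoped ContDiff RealInnerProductSpace

noncomputable section

namespace CascadeInverse

/-- Lebesgue measure on the spatial domain `Ω = (0,1)`. -/
abbrev μΩ : Measure ℝ := volume.restrict (Ioo 0 1)

/-- The space `L²(Ω)`. -/
abbrev L2Ω : Type := Lp ℝ 2 μΩ

/-- `φ` is a test function on the open interval `(a,b)`, that is `φ ∈ C_c^∞((a,b))`. -/
structure IsTest (a b : ℝ) (φ : ℝ → ℝ) : Prop where
  smooth : ContDiff ℝ ∞ φ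
  compact : HasCompactSupport φ
  support : tsupport φ ⊆ Ioo a b

/-- `g` is the weak (distributional) derivative of `f` on `Ω`. -/
def HasWeakDeriv (f g : L2Ω) : Prop :=
  ∀ φ : ℝ → ℝ, IsTest 0 1 φ → ∫ x, f x * deriv φ x ∂μΩ = -∫ x, g x * φ x ∂μΩ

/-- `z = 0` on `∂Ω = {0,1}`: the continuous representative of `z` on `[0,1]` vanishes at both
end points. -/
def ZeroOnBoundary (z : L2Ω) : Prop :=
  ∃ r : ℝ → ℝ, ContinuousOn r (Icc 0 1) ∧ r 0 = 0 ∧ r 1 = 0 ∧ ∀ᵐ x ∂μΩ, z x = r x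

theorem IsTest.memLp {φ : ℝ → ℝ} (h : IsTest 0 1 φ) : MemLp φ 2 μΩ :=
  (h.smooth.continuous.memLp_of_hasCompactSupport h.compact).restrict _

theorem IsTest.memLp_deriv {φ : ℝ → ℝ} (h : IsTest 0 1 φ) : MemLp (deriv φ) 2 μΩ :=
  ((h.smooth.continuous_deriv (by simp)).memLp_of_hasCompactSupport h.compact.deriv).restrict _

theorem integrable_L2_mul (f : L2Ω) {φ : ℝ → ℝ} (h : MemLp φ 2 μΩ) :
    Integrable (fun x => f x * φ x) μΩ :=
  MemLp.integrable_mul (Lp.memLp f) h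

theorem integral_L2_add_mul (f g : L2Ω) {φ : ℝ → ℝ} (h : MemLp φ 2 μΩ) :
    ∫ x, (f + g : L2Ω) x * φ x ∂μΩ = ∫ x, f x * φ x ∂μΩ + ∫ x, g x * φ x ∂μΩ := by
  rw [← integral_add (integrable_L2_mul f h) (integrable_L2_mul g h)]
  refine integral_congr_ae ?_
  filter_upwards [Lp.coeFn_add f g] with x hx
  rw [hx, Pi.add_apply]
  ring

theorem integral_L2_smul_mul (c : ℝ) (f : L2Ω) (φ : ℝ → ℝ) :
    ∫ x, (c • f : L2Ω) x * φ x ∂μΩ = c * ∫ x, f x * φ x ∂μΩ := by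
  rw [← integral_const_mul]
  refine integral_congr_ae ?_
  filter_upwards [Lp.coeFn_smul c f] with x hx
  rw [hx, Pi.smul_apply, smul_eq_mul]
  ring

theorem HasWeakDeriv.add {f g f' g' : L2Ω} (hf : HasWeakDeriv f f') (hg : HasWeakDeriv g g') :
    HasWeakDeriv (f + g) (f' + g') := by
  intro φ hφ
  rw [integral_L2_add_mul _ _ hφ.memLp_deriv, integral_L2_add_mul _ _ hφ.memLp, hf φ hφ, hg φ hφ]
  ring

theorem HasWeakDeriv.smul (c : ℝ) {f f' : L2Ω} (hf : HasWeakDeriv f f') :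
    HasWeakDeriv (c • f) (c • f') := by
  intro φ hφ
  rw [integral_L2_smul_mul, integral_L2_smul_mul, hf φ hφ]
  ring

theorem HasWeakDeriv.zero : HasWeakDeriv 0 0 := by
  simpa using HasWeakDeriv.smul (f := 0) (f' := 0) 0 (fun φ _ => by
    have h0 : ∀ ψ : ℝ → ℝ, ∫ x, (0 : L2Ω) x * ψ x ∂μΩ = 0 := fun ψ => by
      simpa using integral_L2_smul_mul 0 0 ψ
    rw [h0, h0, neg_zero])

/-- The functions of `L²(Ω)` that vanish on the boundary, as a subspace. -/
def zeroTrace : Submodule ℝ L2Ω where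
  carrier := {z | ZeroOnBoundary z}
  zero_mem' := ⟨0, continuousOn_const, rfl, rfl, by
    filter_upwards [Lp.coeFn_zero ℝ 2 μΩ] with x hx using hx⟩
  add_mem' := by
    rintro a b ⟨r, hr, h0, h1, h⟩ ⟨s, hs, k0, k1, k⟩
    refine ⟨r + s, hr.add hs, by simp [h0, k0], by simp [h1, k1], ?_⟩
    filter_upwards [Lp.coeFn_add a b, h, k] with x hx h k
    rw [hx, Pi.add_apply, Pi.add_apply, h, k]
  smul_mem' := by
    rintro c a ⟨r, hr, h0, h1, h⟩
    refine ⟨c • r, hr.const_smul c, by simp [h0], by simp [h1], ?_⟩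
    filter_upwards [Lp.coeFn_smul c a, h] with x hx h
    rw [hx, Pi.smul_apply, Pi.smul_apply, h]

/-- The space of `m`-jets `(f₀, …, f_m)` in `L²(Ω)`, with norm `(∑ ‖f_i‖²)^{1/2}`. -/
abbrev Jet (m : ℕ) : Type := PiLp 2 (fun _ : Fin (m + 1) => L2Ω)

/-- The Sobolev space `H^m(Ω)`. A function `f` is stored with its weak derivatives up to order
`m`, as `(f, f', …, f^{(m)})`; the norm is `‖f‖_{H^m}² = ∑_{i ≤ m} ‖f^{(i)}‖²`. -/
def sobolev (m : ℕ) : Submodule ℝ (Jet m) where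
  carrier := {f | ∀ i : Fin m, HasWeakDeriv (f i.castSucc) (f i.succ)}
  zero_mem' := fun _ => HasWeakDeriv.zero
  add_mem' := fun ha hb i => (ha i).add (hb i)
  smul_mem' := fun c _ ha i => (ha i).smul c

/-- `{z ∈ H^m(Ω) : z = 0 on ∂Ω}`. -/
def sobolevZero (m : ℕ) : Submodule ℝ (Jet m) :=
  sobolev m ⊓ zeroTrace.comap (PiLp.projₗ 2 (fun _ : Fin (m + 1) => L2Ω) 0 : Jet m →ₗ[ℝ] L2Ω)

/-- `H¹(Ω)`. -/
abbrev H1 : Type := sobolev 1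

/-- `H²(Ω)`. -/
abbrev H2 : Type := sobolev 2

/-- `H¹₀(Ω)`. -/
abbrev H10 : Type := sobolevZero 1

/-- `V²₀(Ω) = {z ∈ H²(Ω) : z = 0 on ∂Ω}`. -/
abbrev V02 : Type := sobolevZero 2

/-- The `i`-th weak derivative of an element of a subspace of jets, as a continuous linear map
into `L²(Ω)`. -/
def wderiv {m : ℕ} {S : Submodule ℝ (Jet m)} (i : Fin (m + 1)) : S →L[ℝ] L2Ω :=
  (PiLp.proj 2 (fun _ : Fin (m + 1) => L2Ω) i : Jet m →L[ℝ] L2Ω).comp S.subtypeL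

/-- The inclusion `V²₀(Ω) ⊂ H¹₀(Ω)`. -/
def V02.toH10 (z : V02) : H10 :=
  ⟨WithLp.toLp 2 ![wderiv 0 z, wderiv 1 z], by
    refine ⟨fun i => ?_, z.2.2⟩
    fin_cases i
    exact z.2.1 0⟩

/-- The embedding `V ⊂ L²(Ω) ⊂ V*` of the Gelfand triple: `z ↦ (φ ↦ (z, φ)_{L²(Ω)})`. -/
def toDual {m : ℕ} {S : Submodule ℝ (Jet m)} (z : S) : StrongDual ℝ S :=
  (innerSL ℝ (wderiv 0 z : L2Ω)).comp (wderiv 0)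

/-- `w ∈ L²(0,T;E)`. -/
def InL2 {E : Type*} [NormedAddCommGroup E] (T : ℝ) (w : ℝ → E) : Prop :=
  MemLp w 2 (volume.restrict (Ioo 0 T))

/-- `w'` is the weak time derivative on `(0,T)` of `w`, as a function with values in `V*`. -/
def HasWeakTimeDeriv {m : ℕ} {S : Submodule ℝ (Jet m)} (T : ℝ) (w : ℝ → S)
    (w' : ℝ → StrongDual ℝ S) : Prop :=
  ∀ η : ℝ → ℝ, IsTest 0 T η →
    ∫ t in Ioo 0 T, deriv η t • toDual (w t) = -∫ t in Ioo 0 T, η t • w' t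

/-- `(u,v)` is the weak solution on `(0,T)` of the cascade system
`u_t + u_xxxx = v`, `v_t - (d v_x)_x = 0`, `u = u_xx = v = 0` on `∂Ω`, `u(0) = u₀`, `v(0) = v₀`.

Here `u, v : [0,T] → L²(Ω)` are the continuous representatives, which is what gives the values
at `t = 0` and `t = T` a meaning; `U` and `V` are the same functions seen in `L²(0,T;V²₀)` and
`L²(0,T;H¹₀)`, and `U'`, `V'` are their time derivatives in `L²(0,T;(V²₀)*)` and
`L²(0,T;H⁻¹)`. -/
def IsWeakSolution (T : ℝ) (d : H1) (u₀ v₀ : L2Ω) (u v : ℝ → L2Ω) : Prop :=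
  ContinuousOn u (Icc 0 T) ∧ ContinuousOn v (Icc 0 T) ∧ u 0 = u₀ ∧ v 0 = v₀ ∧
  ∃ (U : ℝ → V02) (V : ℝ → H10) (U' : ℝ → StrongDual ℝ V02) (V' : ℝ → StrongDual ℝ H10),
    (∀ᵐ t ∂volume.restrict (Ioo 0 T), wderiv 0 (U t) = u t ∧ wderiv 0 (V t) = v t) ∧
    InL2 T U ∧ InL2 T V ∧ InL2 T U' ∧ InL2 T V' ∧
    HasWeakTimeDeriv T U U' ∧ HasWeakTimeDeriv T V V' ∧
    ∀ᵐ t ∂volume.restrict (Ioo 0 T), ∀ φ : V02,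
      U' t φ + ⟪(wderiv 2 (U t) : L2Ω), wderiv 2 φ⟫ = ⟪(wderiv 0 (V t) : L2Ω), wderiv 0 φ⟫ ∧
      V' t φ.toH10 +
        ∫ x, (wderiv 0 d : L2Ω) x * (wderiv 1 (V t) : L2Ω) x * (wderiv 1 φ : L2Ω) x ∂μΩ = 0

/-- The class `𝒟 = {d ∈ H¹(Ω) : α₀ ≤ d ≤ α₁ on Ω, ‖d‖_{H¹} ≤ α₂}` of admissible coefficients. -/
def admissible (α₀ α₁ α₂ : ℝ) : Set H1 :=
  {d | (∀ᵐ x ∂μΩ, α₀ ≤ (wderiv 0 d : L2Ω) x ∧ (wderiv 0 d : L2Ω) x ≤ α₁) ∧ ‖d‖ ≤ α₂}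

/-- The embedding of `𝒦 = H¹₀(Ω) × L²(Ω)` into `L²(Ω) × L²(Ω)`. -/
def embK (k : H10 × L2Ω) : L2Ω × L2Ω := (wderiv 0 k.1, k.2)

/-- `k ∈ 𝒦` is the final state `(u(T;d), v(T;d))` of a weak solution with coefficient `d`. -/
def IsFinalState (T : ℝ) (u₀ v₀ : L2Ω) (d : H1) (k : H10 × L2Ω) : Prop :=
  ∃ u v : ℝ → L2Ω, IsWeakSolution T d u₀ v₀ u v ∧ embK k = (u T, v T)

/-- The input-output operator `Ψ : 𝒟 → 𝒦`, `Ψ[d] = (u(T;d), v(T;d))`. (The arbitrary value that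
`epsilon` would take if there were no final state plays no role where one exists.) -/
def inputOutput (T : ℝ) (u₀ v₀ : L2Ω) {α₀ α₁ α₂ : ℝ} (d : admissible α₀ α₁ α₂) : H10 × L2Ω :=
  Classical.epsilon (IsFinalState T u₀ v₀ d)

/-- A (nonlinear) map is compact if it is continuous and maps bounded sets to relatively compact
sets. -/
def IsCompactMap {X Y : Type*} [PseudoMetricSpace X] [TopologicalSpace Y] (F : X → Y) : Prop :=
  Continuous F ∧ ∀ B : Set X, Bornology.IsBounded B → IsCompact (closure (F '' B))

/-- The equation `F x = y` is ill-posed in the sense that the solution does not depend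
continuously on the data: there are data `F (x n)` converging to `F x` for which the solutions
`x n` do not converge to `x`. -/
def IsUnstable {X Y : Type*} [TopologicalSpace X] [TopologicalSpace Y] (F : X → Y) : Prop :=
  ∃ (x : X) (s : ℕ → X), Tendsto (fun n => F (s n)) atTop (𝓝 (F x)) ∧ ¬ Tendsto s atTop (𝓝 x)

end CascadeInverse

end

open CascadeInverse

/-! Each equation of the cascade is an abstract parabolic problem `w' + a w = F` for a symmetric
coercive form `a` on a Hilbert space `V` compactly and densely embedded in `H = L²(Ω)`. The solution
operator of `a` is compact, symmetric and positive on `H`, so `H` has a Hilbert basis of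
eigenvectors (`exists_eigenSystem`). In this basis a weak solution splits into scalar equations `y'
+ λ y = f`, which are solved by Duhamel's formula (`EigenSystem.duhamel`).

The analysis then rests on scalar facts. The Duhamel kernel gains a factor `1/(2λ)` in the square
(`mul_sq_duhamel_le`), and `2λ exp(-2λT) ≤ 1/T`. Summed over the basis they give existence
(`EigenSystem.exists_isSolution`), stability against perturbations of `F` in the dual norm
(`EigenSystem.norm_sub_sq_le`), and smoothing of the final state into `V`
(`EigenSystem.exists_lift_final`). Only the coercivity constant of `a` enters the stability and
smoothing bounds, so for the diffusion equation they are uniform over coefficients `d ≥ α₀`.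

Stability, applied with the term `((d' - d) v_x)_x` moved to the right-hand side, shows that the
final state is Lipschitz in `d` at each fixed coefficient with respect to the supremum norm
(`IsWeakSolution.exists_lipschitz`). Uniqueness is the case of equal coefficients, and continuity
follows from `H¹ ⊂ L^∞`. Smoothing bounds the final states in `V²₀ × H¹₀`, which embeds compactly
into `L² × L²`. Finally, the perturbations `sin((n+1)πx)/(n+1)` tend to zero uniformly but not in
`H¹`, so the inverse is not continuous. -/

noncomputable section

namespace CascadeInverse

/-! ### Eigenvector bases of symmetric coercive forms. -/

section Spectral

variable {V H : Type*} [NormedAddCommGroup V] [InnerProductSpace ℝ V]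
  [NormedAddCommGroup H] [InnerProductSpace ℝ H]

/-- A complete system of eigenvectors of the form `a` on `V` relative to the embedding `j` of `V`
into `H`, whose images in `H` form a Hilbert basis. -/
structure EigenSystem (j : V →L[ℝ] H) (a : V →L[ℝ] V →L[ℝ] ℝ) (ι : Type*) where
  /-- the eigenvectors in `H` -/
  basis : HilbertBasis ι ℝ H
  /-- the eigenvectors in `V` -/
  vec : ι → V
  /-- the eigenvalues -/
  val : ι → ℝ
  map_vec : ∀ i, j (vec i) = basis i
  val_pos : ∀ i, 0 < val i
  form_vec : ∀ i φ, a (vec i) φ = val i * ⟪basis i, j φ⟫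

/-- Distinct basis vectors are at distance `√2`, so the balls of radius `1/2` around them are
disjoint. Countability is needed later to interchange sums with integrals and to take measurable
limits. -/
theorem _root_.HilbertBasis.countable_index {ι : Type*} [TopologicalSpace.SeparableSpace H]
    (b : HilbertBasis ι ℝ H) : Countable ι := by
  refine Pairwise.countable_of_isOpen_disjoint (s := fun i => Metric.ball (b i) (1 / 2)) ?_
    (fun _ => Metric.isOpen_ball) (fun i => ⟨b i, Metric.mem_ball_self (by norm_num)⟩)
  intro i k hik
  refine Metric.ball_disjoint_ball ?_
  rw [dist_eq_norm]
  have h : ‖b i - b k‖ ^ 2 = 2 := by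
    rw [norm_sub_sq_real, b.orthonormal.1 i, b.orthonormal.1 k, b.orthonormal.2 hik]
    norm_num
  nlinarith [norm_nonneg (b i - b k)]

/-- The solution operator `H → V` of the variational problem `a(u, φ) = (h, jφ)`. -/
theorem _root_.IsCoercive.exists_solutionOperator [CompleteSpace V] [CompleteSpace H]
    {a : V →L[ℝ] V →L[ℝ] ℝ} (hc : IsCoercive a) (j : V →L[ℝ] H) :
    ∃ G : H →L[ℝ] V, ∀ h φ, a (G h) φ = ⟪h, j φ⟫ := by
  refine ⟨(hc.continuousLinearEquivOfBilin.symm : V →L[ℝ] V).comp j.adjoint, fun h φ => ?_⟩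
  rw [← hc.continuousLinearEquivOfBilin_apply]
  simp [ContinuousLinearMap.adjoint_inner_left]

/-- The spectral theorem for the compact symmetric operator `K = j ∘ G`: Hilbert bases of its
eigenspaces are glued together. An eigenvalue `μ` of `K` becomes the eigenvalue `μ⁻¹` of the form,
and `μ⁻¹ • G b` lifts the eigenvector `b` to `V`. -/
theorem exists_eigenSystem.{u, v} {V : Type v} {H : Type u} [NormedAddCommGroup V]
    [InnerProductSpace ℝ V]
    [CompleteSpace V] [NormedAddCommGroup H] [InnerProductSpace ℝ H] [CompleteSpace H]
    [TopologicalSpace.SeparableSpace H] {j : V →L[ℝ] H} {a : V →L[ℝ] V →L[ℝ] ℝ}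
    (hj : IsCompactOperator j) (hd : ∀ h, (∀ φ, ⟪h, j φ⟫ = 0) → h = 0)
    (hs : ∀ v w, a v w = a w v) (hc : IsCoercive a) :
    ∃ ι : Type u, Countable ι ∧ Nonempty (EigenSystem j a ι) := by
  obtain ⟨G, hG⟩ := hc.exists_solutionOperator j
  set K : H →L[ℝ] H := j.comp G with hK
  have hKc : IsCompactOperator K := hj.comp_clm G
  have hKG : ∀ h k, ⟪K h, k⟫ = a (G k) (G h) := fun h k => by
    rw [hG, real_inner_comm]; rfl
  have hKs : (K : H →ₗ[ℝ] H).IsSymmetric := fun h k => by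
    change ⟪K h, k⟫ = ⟪h, K k⟫
    rw [real_inner_comm (K k), hKG, hKG, hs]
  -- `G h = 0` would make `h` orthogonal to the range of `j`, hence zero; so `⟪K h, h⟫ = a (G h) (G
  -- h)` is strictly positive.
  have hpos : ∀ (μ : ℝ) (h : H), h ≠ 0 → K h = μ • h → 0 < μ := by
    intro μ h hh hμ
    have h1 : 0 < a (G h) (G h) := by
      obtain ⟨c, hc0, hc⟩ := hc
      have hGh : G h ≠ 0 := fun h0 => hh <| hd h fun φ => by rw [← hG, h0]; simp
      exact lt_of_lt_of_le (by have := norm_pos_iff.2 hGh; positivity) (hc (G h))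
    rw [← hKG, hμ, inner_smul_left, real_inner_self_eq_norm_sq] at h1
    exact pos_of_mul_pos_left h1 (sq_nonneg _)
  have hE : OrthogonalFamily ℝ (fun μ => Module.End.eigenspace (K : H →ₗ[ℝ] H) μ)
      fun μ => (Module.End.eigenspace (K : H →ₗ[ℝ] H) μ).subtypeₗᵢ :=
    hKs.orthogonalFamily_eigenspaces
  have hcl : ∀ μ, CompleteSpace (Module.End.eigenspace (K : H →ₗ[ℝ] H) μ) := by
    intro μ
    refine IsClosed.completeSpace_coe (hs := ?_)
    have : (Module.End.eigenspace (K : H →ₗ[ℝ] H) μ : Set H) = {h | K h = μ • h} := by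
      ext h; exact Module.End.mem_eigenspace_iff
    rw [this]
    exact isClosed_eq K.continuous (continuous_const_smul μ)
  -- The index ranges over all real `μ`; those that are not eigenvalues have zero eigenspace and
  -- contribute no basis vector.
  choose w b hb using fun μ =>
    exists_hilbertBasis ℝ (Module.End.eigenspace (K : H →ₗ[ℝ] H) μ)
  have hon : Orthonormal ℝ fun p : Σ μ, w μ => ((b p.1 p.2 : _) : H) :=
    hE.orthonormal_sigma_orthonormal (v_family := fun μ => b μ) fun μ => (b μ).orthonormal
  have hbot : (Submodule.span ℝ (range fun p : Σ μ, w μ => ((b p.1 p.2 : _) : H)))ᗮ = ⊥ := by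
    rw [← K.orthogonalComplement_iSup_eigenspaces_eq_bot hKc hKs]
    refine le_antisymm ?_ (Submodule.orthogonal_le ?_)
    · intro x hx
      rw [Submodule.mem_orthogonal'] at hx ⊢
      -- A vector orthogonal to every basis vector annihilates each eigenspace, because the
      -- expansions there converge.
      have hle : (⨆ μ, Module.End.eigenspace (K : H →ₗ[ℝ] H) μ) ≤
          LinearMap.ker (innerSL ℝ x : H →ₗ[ℝ] ℝ) := by
        refine iSup_le fun μ y hy => ?_
        have hsum := (((b μ).hasSum_repr ⟨y, hy⟩).mapL
          (Module.End.eigenspace (K : H →ₗ[ℝ] H) μ).subtypeL).mapL (innerSL ℝ x)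
        refine hsum.unique ?_
        have h0 : ∀ k : w μ, ⟪x, (b μ k : H)⟫ = 0 := fun k =>
          hx _ (Submodule.subset_span ⟨⟨μ, k⟩, rfl⟩)
        simp [h0, hasSum_zero]
      exact fun u hu => hle hu
    · rw [Submodule.span_le]
      rintro _ ⟨p, rfl⟩
      exact Submodule.mem_iSup_of_mem p.1 (b p.1 p.2).2
  have hmem : ∀ p : Σ μ, w μ, K (b p.1 p.2 : H) = p.1 • (b p.1 p.2 : H) := fun p =>
    Module.End.mem_eigenspace_iff.1 (b p.1 p.2).2
  have hp : ∀ p : Σ μ, w μ, 0 < p.1 := fun p => hpos p.1 _ (hon.ne_zero p) (hmem p)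
  let B := HilbertBasis.mkOfOrthogonalEqBot hon hbot
  have hB : ∀ p : Σ μ, w μ, B p = (b p.1 p.2 : H) := fun p => by simp [B]
  refine ⟨_, B.countable_index, ⟨⟨B, fun p : Σ μ, w μ => p.1⁻¹ • G (b p.1 p.2 : H),
    fun p : Σ μ, w μ => p.1⁻¹, ?_, ?_, ?_⟩⟩⟩
  · intro p
    rw [map_smul, hB]
    change p.1⁻¹ • K _ = _
    rw [hmem, inv_smul_smul₀ (hp p).ne']
  · exact fun p => inv_pos.2 (hp p)
  · intro p φ
    rw [map_smul, hB, smul_apply, hG, smul_eq_mul]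

end Spectral

/-! ### Test functions, weak derivatives and primitives on an interval. -/

section Primitives

/-- Integration by parts for primitives of integrable functions. -/
theorem integral_primitive_mul_add {a b : ℝ} {f g : ℝ → ℝ}
    (hf : IntervalIntegrable f volume a b) (hg : IntervalIntegrable g volume a b) (p q : ℝ) :
    ∫ x in a..b, (f x * (q + ∫ s in a..x, g s) + (p + ∫ s in a..x, f s) * g x) =
      (p + ∫ s in a..b, f s) * (q + ∫ s in a..b, g s) - p * q := by
  have hac : ∀ {h : ℝ → ℝ} (r : ℝ), IntervalIntegrable h volume a b →
      AbsolutelyContinuousOnInterval (fun x => r + ∫ s in a..x, h s) a b := fun r hh => by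
    have h1 : AbsolutelyContinuousOnInterval (fun _ : ℝ => r) a b :=
      (contDiffOn_const (n := 1)).absolutelyContinuousOnInterval
    exact h1.add (hh.absolutelyContinuousOnInterval_intervalIntegral left_mem_uIcc)
  have h := (hac p hf).integral_deriv_mul_eq_sub (hac q hg)
  simp only [intervalIntegral.integral_same, add_zero] at h
  rw [← h]
  refine intervalIntegral.integral_congr_ae ?_
  filter_upwards [hf.ae_hasDerivAt_integral, hg.ae_hasDerivAt_integral] with x hx hy hxm
  have hm := uIoc_subset_uIcc hxm
  rw [((hx hm a left_mem_uIcc).const_add p).deriv, ((hy hm a left_mem_uIcc).const_add q).deriv]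

theorem IsTest.eq_zero {a b : ℝ} {φ : ℝ → ℝ} (h : IsTest a b φ) {x : ℝ} (hx : x ∉ Ioo a b) :
    φ x = 0 :=
  image_eq_zero_of_notMem_tsupport fun hx' => hx (h.support hx')

theorem IsTest.continuous {a b : ℝ} {φ : ℝ → ℝ} (h : IsTest a b φ) : Continuous φ :=
  h.smooth.continuous

theorem IsTest.contDiff_deriv {a b : ℝ} {φ : ℝ → ℝ} (h : IsTest a b φ) :
    ContDiff ℝ ∞ (deriv φ) :=
  (contDiff_infty_iff_deriv.1 h.smooth).2

theorem IsTest.continuous_deriv {a b : ℝ} {φ : ℝ → ℝ} (h : IsTest a b φ) :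
    Continuous (deriv φ) :=
  h.contDiff_deriv.continuous

theorem IsTest.hasDerivAt {a b : ℝ} {φ : ℝ → ℝ} (h : IsTest a b φ) (x : ℝ) :
    HasDerivAt φ (deriv φ x) x :=
  (contDiff_infty_iff_deriv.1 h.smooth).1.differentiableAt.hasDerivAt

theorem IsTest.deriv {a b : ℝ} {φ : ℝ → ℝ} (h : IsTest a b φ) : IsTest a b (deriv φ) :=
  ⟨h.contDiff_deriv, h.compact.deriv, tsupport_deriv_subset.trans h.support⟩

theorem IsTest.integral_deriv {a b : ℝ} {φ : ℝ → ℝ} (h : IsTest a b φ) (x : ℝ) :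
    ∫ s in a..x, _root_.deriv φ s = φ x := by
  rw [intervalIntegral.integral_eq_sub_of_hasDerivAt (fun s _ => h.hasDerivAt s)
    (h.continuous_deriv.intervalIntegrable _ _), h.eq_zero left_notMem_Ioo, sub_zero]

theorem IsTest.mul {a b : ℝ} {φ ψ : ℝ → ℝ} (h : IsTest a b φ) (hψ : ContDiff ℝ ∞ ψ) :
    IsTest a b (fun x => φ x * ψ x) :=
  ⟨h.smooth.mul hψ, h.compact.mul_right, (tsupport_mul_subset_left).trans h.support⟩

theorem IsTest.sub {a b : ℝ} {φ ψ : ℝ → ℝ} (h : IsTest a b φ) (hψ : IsTest a b ψ) :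
    IsTest a b (fun x => φ x - ψ x) :=
  ⟨h.smooth.sub hψ.smooth, h.compact.sub hψ.compact,
    (tsupport_sub φ ψ).trans (union_subset h.support hψ.support)⟩

theorem integral_Ioo_eq_intervalIntegral {E : Type*} [NormedAddCommGroup E] [NormedSpace ℝ E]
    {a b : ℝ} (hab : a ≤ b) (f : ℝ → E) : ∫ x in Ioo a b, f x = ∫ x in a..b, f x := by
  rw [intervalIntegral.integral_of_le hab, integral_Ioc_eq_integral_Ioo]

/-- A primitive of an integrable function has that function as its weak derivative. -/
theorem integral_primitive_mul_deriv {a b : ℝ} (hab : a ≤ b) {g : ℝ → ℝ}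
    (hg : IntegrableOn g (Ioo a b)) (p : ℝ) {η : ℝ → ℝ} (hη : IsTest a b η) :
    ∫ x in Ioo a b, (p + ∫ s in a..x, g s) * deriv η x = -∫ x in Ioo a b, g x * η x := by
  have hg' : IntervalIntegrable g volume a b :=
    (intervalIntegrable_iff_integrableOn_Ioo_of_le hab).2 hg
  have hη' : IntervalIntegrable (deriv η) volume a b := hη.continuous_deriv.intervalIntegrable _ _
  have h := integral_primitive_mul_add hg' hη' p 0
  simp only [hη.integral_deriv, zero_add, hη.eq_zero right_notMem_Ioo, mul_zero, sub_zero] at h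
  rw [intervalIntegral.integral_add (hg'.mul_continuousOn hη.continuous.continuousOn)] at h
  · rw [integral_Ioo_eq_intervalIntegral hab, integral_Ioo_eq_intervalIntegral hab]
    linarith
  · refine hη'.continuousOn_mul ?_
    exact continuousOn_const.add
      (intervalIntegral.continuousOn_primitive_interval' hg' left_mem_uIcc)

/-- The primitive of a test function with zero mean is a test function. -/
theorem IsTest.primitive {a b : ℝ} (hab : a < b) {θ : ℝ → ℝ} (h : IsTest a b θ)
    (h0 : ∫ x in a..b, θ x = 0) : IsTest a b (fun x => ∫ s in a..x, θ s) := by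
  -- The support of `θ` lies in some `[c, d] ⊂ (a, b)`. The primitive vanishes left of `c`, and
  -- right of `d` it equals the full integral, which is zero.
  obtain ⟨c, d, hc, hd, hcd⟩ : ∃ c d, a < c ∧ d < b ∧ tsupport θ ⊆ Icc c d := by
    rcases (tsupport θ).eq_empty_or_nonempty with he | hne
    · obtain ⟨c, hc⟩ := exists_between hab
      exact ⟨c, c, hc.1, hc.2, by simp [he]⟩
    · obtain ⟨c, hc⟩ := h.compact.isCompact.exists_isLeast hne
      obtain ⟨d, hd⟩ := h.compact.isCompact.exists_isGreatest hne
      exact ⟨c, d, (h.support hc.1).1, (h.support hd.1).2, fun x hx => ⟨hc.2 hx, hd.2 hx⟩⟩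
  have hθ : ∀ x, x ∉ Icc c d → θ x = 0 := fun x hx =>
    image_eq_zero_of_notMem_tsupport fun hx' => hx (hcd hx')
  have hI : ∀ x y, IntervalIntegrable θ volume x y := fun x y =>
    h.continuous.intervalIntegrable x y
  have hsupp : Function.support (fun x => ∫ s in a..x, θ s) ⊆ Icc c d := by
    intro x hx
    by_contra hxcd
    refine hx ?_
    rcases lt_or_ge x c with hxc | hxc
    · refine (intervalIntegral.integral_congr (g := fun _ => 0) fun s hs => hθ s ?_).trans
        (by simp)
      have := hs.2
      exact fun hs' => absurd hs'.1 (not_le.2 (this.trans_lt (max_lt hc hxc)))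
    · have hxd : d < x := by
        by_contra hle
        exact hxcd ⟨hxc, not_lt.1 hle⟩
      have h1 := intervalIntegral.integral_add_adjacent_intervals (hI a x) (hI x b)
      have h2 : ∫ s in x..b, θ s = 0 := by
        refine (intervalIntegral.integral_congr (g := fun _ => 0) fun s hs => hθ s ?_).trans
          (by simp)
        have := hs.1
        exact fun hs' => absurd hs'.2 (not_le.2 ((lt_min hxd hd).trans_le this))
      change ∫ s in a..x, θ s = 0
      linarith
  have hder : ∀ x, HasDerivAt (fun x => ∫ s in a..x, θ s) (θ x) x := fun x =>
    intervalIntegral.integral_hasDerivAt_right (hI a x)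
      (h.continuous.stronglyMeasurableAtFilter _ _) h.continuous.continuousAt
  refine ⟨contDiff_infty_iff_deriv.2 ⟨fun x => (hder x).differentiableAt, ?_⟩, ?_, ?_⟩
  · rw [funext fun x => (hder x).deriv]
    exact h.smooth
  · exact HasCompactSupport.intro isCompact_Icc fun x hx => by
      by_contra hx'
      exact hx (hsupp hx')
  · exact (closure_minimal hsupp isClosed_Icc).trans fun x hx =>
      ⟨hc.trans_le hx.1, hx.2.trans_lt hd⟩

theorem exists_isTest_integral_eq_one {a b : ℝ} (hab : a < b) :
    ∃ χ, IsTest a b χ ∧ ∫ x in Ioo a b, χ x = 1 := by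
  let B : ContDiffBump ((a + b) / 2) := ⟨(b - a) / 8, (b - a) / 4, by linarith, by linarith⟩
  have hsub : tsupport (B.normed volume) ⊆ Ioo a b := by
    rw [B.tsupport_normed_eq, Real.closedBall_eq_Icc]
    intro x hx
    constructor <;> [have := hx.1; have := hx.2] <;> simp only [B] at this <;> linarith
  refine ⟨B.normed volume, ⟨B.contDiff_normed, B.hasCompactSupport_normed, hsub⟩, ?_⟩
  rw [setIntegral_eq_integral_of_forall_compl_eq_zero, B.integral_normed]
  exact fun x hx => image_eq_zero_of_notMem_tsupport fun h => hx (hsub h)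

/-- A function orthogonal to all test functions vanishes. -/
theorem ae_eq_zero_of_integral_test {a b : ℝ} {z : ℝ → ℝ} (hz : IntegrableOn z (Ioo a b))
    (h : ∀ η, IsTest a b η → ∫ t in Ioo a b, z t * η t = 0) :
    ∀ᵐ t ∂volume.restrict (Ioo a b), z t = 0 := by
  rw [ae_restrict_iff' measurableSet_Ioo]
  refine isOpen_Ioo.ae_eq_zero_of_integral_contDiff_smul_eq_zero hz.locallyIntegrableOn ?_
  intro g h1 h2 h3
  rw [← h g ⟨h1, h2, h3⟩, setIntegral_eq_integral_of_forall_compl_eq_zero]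
  · simp only [smul_eq_mul, mul_comm]
  · intro x hx
    rw [IsTest.eq_zero ⟨h1, h2, h3⟩ hx, mul_zero]

theorem IsTest.integrable_mul {a b : ℝ} {z η : ℝ → ℝ} (hz : IntegrableOn z (Ioo a b))
    (hη : IsTest a b η) : IntegrableOn (fun t => z t * η t) (Ioo a b) := by
  obtain ⟨C, hC⟩ := hη.compact.exists_bound_of_continuous hη.continuous
  exact hz.mul_bdd (c := C) hη.continuous.aestronglyMeasurable (Eventually.of_forall hC)

/-- The lemma of du Bois-Reymond. -/
theorem exists_ae_eq_const_of_integral_mul_deriv {a b : ℝ} (hab : a < b) {z : ℝ → ℝ}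
    (hz : IntegrableOn z (Ioo a b))
    (h : ∀ η, IsTest a b η → ∫ t in Ioo a b, z t * deriv η t = 0) :
    ∃ c, ∀ᵐ t ∂volume.restrict (Ioo a b), z t = c := by
  obtain ⟨χ, hχ, hχ1⟩ := exists_isTest_integral_eq_one hab
  refine ⟨∫ t in Ioo a b, z t * χ t, ?_⟩
  set c := ∫ t in Ioo a b, z t * χ t
  have key := ae_eq_zero_of_integral_test (a := a) (b := b) (z := fun t => z t - c)
    (hz.sub (integrable_const c)) ?_
  · filter_upwards [key] with t ht using sub_eq_zero.1 ht
  intro ψ hψ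
  set m := ∫ t in Ioo a b, ψ t with hm
  -- Removing the mean of `ψ` with the help of `χ` leaves the derivative of a test function, to
  -- which the hypothesis applies.
  have hθ : IsTest a b (fun t => ψ t - χ t * m) := hψ.sub (hχ.mul contDiff_const)
  have hψI : IntegrableOn ψ (Ioo a b) := hψ.continuous.integrableOn_Ioc.mono_set Ioo_subset_Ioc_self
  have hχI : IntegrableOn χ (Ioo a b) := hχ.continuous.integrableOn_Ioc.mono_set Ioo_subset_Ioc_self
  have hθ0 : ∫ t in a..b, (ψ t - χ t * m) = 0 := by
    rw [← integral_Ioo_eq_intervalIntegral hab.le, integral_sub hψI (hχI.mul_const m),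
      integral_mul_const, hχ1, ← hm]
    ring
  have h1 := h _ (hθ.primitive hab hθ0)
  have hder : ∀ x, deriv (fun x => ∫ s in a..x, (ψ s - χ s * m)) x = ψ x - χ x * m := fun x =>
    (intervalIntegral.integral_hasDerivAt_right (hθ.continuous.intervalIntegrable a x)
      (hθ.continuous.stronglyMeasurableAtFilter _ _) hθ.continuous.continuousAt).deriv
  simp only [hder] at h1
  have e1 : ∀ t, z t * (ψ t - χ t * m) = z t * ψ t - z t * χ t * m := fun t => by ring
  have e2 : ∀ t, (z t - c) * ψ t = z t * ψ t - c * ψ t := fun t => by ring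
  simp only [e1] at h1
  simp only [e2]
  rw [integral_sub (hψ.integrable_mul hz) ((hχ.integrable_mul hz).mul_const m),
    integral_mul_const] at h1
  rw [integral_sub (hψ.integrable_mul hz) (hψI.const_mul c), integral_const_mul]
  exact h1

/-- An integrable function with integrable weak derivative is a primitive of its derivative. -/
theorem exists_ae_eq_primitive {a b : ℝ} (hab : a < b) {y g : ℝ → ℝ}
    (hy : IntegrableOn y (Ioo a b)) (hg : IntegrableOn g (Ioo a b))
    (h : ∀ η, IsTest a b η → ∫ t in Ioo a b, y t * deriv η t = -∫ t in Ioo a b, g t * η t) :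
    ∃ c, ∀ᵐ t ∂volume.restrict (Ioo a b), y t = c + ∫ s in a..t, g s := by
  have hg' : IntervalIntegrable g volume a b :=
    (intervalIntegrable_iff_integrableOn_Ioo_of_le hab.le).2 hg
  have hG : IntegrableOn (fun x => ∫ s in a..x, g s) (Ioo a b) :=
    (intervalIntegral.continuousOn_primitive_interval' hg' left_mem_uIcc).integrableOn_uIcc.mono_set
      (Ioo_subset_Icc_self.trans Icc_subset_uIcc)
  have hz : ∀ η, IsTest a b η →
      ∫ t in Ioo a b, (y t - ∫ s in a..t, g s) * deriv η t = 0 := by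
    intro η hη
    have h2 := integral_primitive_mul_deriv hab.le hg 0 hη
    simp only [zero_add] at h2
    simp only [sub_mul]
    rw [integral_sub (hη.deriv.integrable_mul hy) (hη.deriv.integrable_mul hG), h η hη, h2,
      sub_self]
  obtain ⟨c, hc⟩ := exists_ae_eq_const_of_integral_mul_deriv hab (hy.sub hG) hz
  refine ⟨c, ?_⟩
  filter_upwards [hc] with t ht
  rw [← ht]
  change _ = y t - _ + _
  ring

end Primitives

/-! ### The scalar equation `y' + r y = f`. -/

section Duhamel

/-- Cauchy–Schwarz, from the discriminant of the nonnegative quadratic `r ↦ ∫ (r f + g)²`. -/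
theorem sq_integral_mul_le {α : Type*} [MeasurableSpace α] {μ : Measure α} {f g : α → ℝ}
    (hf : MemLp f 2 μ) (hg : MemLp g 2 μ) :
    (∫ x, f x * g x ∂μ) ^ 2 ≤ (∫ x, f x ^ 2 ∂μ) * ∫ x, g x ^ 2 ∂μ := by
  have hfg : Integrable (fun x => f x * g x) μ := hf.integrable_mul hg
  have h := discrim_le_zero (a := ∫ x, f x ^ 2 ∂μ) (b := 2 * ∫ x, f x * g x ∂μ)
    (c := ∫ x, g x ^ 2 ∂μ) fun r => by
      have h0 : 0 ≤ ∫ x, (r * f x + g x) ^ 2 ∂μ := integral_nonneg fun x => sq_nonneg _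
      have e : ∀ x, (r * f x + g x) ^ 2 = r * r * f x ^ 2 + 2 * r * (f x * g x) + g x ^ 2 :=
        fun x => by ring
      simp only [e] at h0
      rw [integral_add (f := fun x => r * r * f x ^ 2 + 2 * r * (f x * g x))
        ((hf.integrable_sq.const_mul _).add (hfg.const_mul _)) hg.integrable_sq,
        integral_add (hf.integrable_sq.const_mul _) (hfg.const_mul _), integral_const_mul,
        integral_const_mul] at h0
      linarith
  rw [discrim] at h
  linarith

theorem memLp_of_continuousOn {E : Type*} [NormedAddCommGroup E] {a b : ℝ} {f : ℝ → E}
    (hf : ContinuousOn f (Icc a b)) : MemLp f 2 (volume.restrict (Ioo a b)) := by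
  obtain ⟨C, hC⟩ := isCompact_Icc.exists_bound_of_continuousOn hf
  refine MemLp.of_bound ((hf.mono Ioo_subset_Icc_self).aestronglyMeasurable measurableSet_Ioo) C ?_
  exact (ae_restrict_iff' measurableSet_Ioo).2
    (Eventually.of_forall fun t ht => hC t (Ioo_subset_Icc_self ht))

theorem hasDerivAt_exp_mul (r t : ℝ) :
    HasDerivAt (fun s => Real.exp (r * s)) (r * Real.exp (r * t)) t := by
  have h := ((hasDerivAt_id t).const_mul r).exp
  simpa [mul_comm] using h

/-- The left side equals `1 - exp(-2rt)`; in the multiplied form no sign or nonvanishing of `r` is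
needed. -/
theorem integral_sq_exp_le (r t : ℝ) :
    2 * r * ∫ s in 0..t, Real.exp (-r * (t - s)) ^ 2 ≤ 1 := by
  have e : ∀ s, Real.exp (-r * (t - s)) ^ 2 = Real.exp (-(2 * r) * t) * Real.exp (2 * r * s) :=
    fun s => by
      rw [← Real.exp_nat_mul, ← Real.exp_add]
      congr 1
      push_cast
      ring
  have hI : ∫ s in 0..t, 2 * r * Real.exp (2 * r * s) = Real.exp (2 * r * t) - 1 := by
    rw [intervalIntegral.integral_eq_sub_of_hasDerivAt (fun s _ => hasDerivAt_exp_mul (2 * r) s)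
      ((by fun_prop : Continuous fun s => 2 * r * Real.exp (2 * r * s)).intervalIntegrable 0 t)]
    simp
  rw [intervalIntegral.integral_const_mul] at hI
  simp only [e]
  rw [intervalIntegral.integral_const_mul]
  have h1 : Real.exp (-(2 * r) * t) * Real.exp (2 * r * t) = 1 := by
    rw [← Real.exp_add]; simp
  have h2 := Real.exp_pos (-(2 * r) * t)
  calc _ = Real.exp (-(2 * r) * t) * (2 * r * ∫ s in 0..t, Real.exp (2 * r * s)) := by ring
    _ = 1 - Real.exp (-(2 * r) * t) := by rw [hI, mul_sub, h1, mul_one]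
    _ ≤ 1 := by linarith

/-- Cauchy–Schwarz against the kernel. The gain of one power of `r` lets a source in `V*` control
`w` in `H`, and a source in `H` control `w` in `V`. -/
theorem mul_sq_duhamel_le {r : ℝ} (hr : 0 < r) {T t : ℝ} (ht : t ∈ Icc 0 T) {f : ℝ → ℝ}
    (hf : MemLp f 2 (volume.restrict (Ioo 0 T))) :
    2 * r * (∫ s in 0..t, Real.exp (-r * (t - s)) * f s) ^ 2 ≤ ∫ s in Ioo 0 T, f s ^ 2 := by
  have hsub : Ioo 0 t ⊆ Ioo 0 T := Ioo_subset_Ioo_right ht.2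
  have hft : MemLp f 2 (volume.restrict (Ioo 0 t)) :=
    hf.mono_measure (Measure.restrict_mono_set _ hsub)
  have he : MemLp (fun s => Real.exp (-r * (t - s))) 2 (volume.restrict (Ioo 0 t)) :=
    memLp_of_continuousOn (by fun_prop)
  have h1 := sq_integral_mul_le he hft
  have h2 := integral_sq_exp_le r t
  have h3 : ∫ s in Ioo 0 t, f s ^ 2 ≤ ∫ s in Ioo 0 T, f s ^ 2 :=
    setIntegral_mono_set hf.integrable_sq (Eventually.of_forall fun _ => sq_nonneg _)
      hsub.eventuallyLE
  have h4 : 0 ≤ ∫ s in Ioo 0 t, f s ^ 2 := integral_nonneg fun _ => sq_nonneg _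
  rw [← integral_Ioo_eq_intervalIntegral ht.1] at h2 ⊢
  calc _ ≤ 2 * r * ((∫ s in Ioo 0 t, Real.exp (-r * (t - s)) ^ 2) * ∫ s in Ioo 0 t, f s ^ 2) := by
        gcongr
    _ = (2 * r * ∫ s in Ioo 0 t, Real.exp (-r * (t - s)) ^ 2) * ∫ s in Ioo 0 t, f s ^ 2 := by ring
    _ ≤ 1 * ∫ s in Ioo 0 t, f s ^ 2 := by gcongr
    _ ≤ _ := by rwa [one_mul]

/-- Variation of constants for weak solutions of `y' + r y = f`. -/
theorem eq_duhamel_of_weak {T : ℝ} (hT : 0 < T) {r : ℝ} {y f : ℝ → ℝ}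
    (hy : ContinuousOn y (Icc 0 T)) (hf : IntegrableOn f (Ioo 0 T))
    (h : ∀ η, IsTest 0 T η →
      ∫ t in Ioo 0 T, y t * deriv η t = -∫ t in Ioo 0 T, (f t - r * y t) * η t) :
    ∀ t ∈ Icc 0 T, y t = Real.exp (-r * t) * y 0 + ∫ s in 0..t, Real.exp (-r * (t - s)) * f s := by
  have hexp : ContDiff ℝ ∞ fun t => Real.exp (r * t) := by fun_prop
  have hyI : IntegrableOn y (Ioo 0 T) := hy.integrableOn_Icc.mono_set Ioo_subset_Icc_self
  have hmul : ∀ {u : ℝ → ℝ}, IntegrableOn u (Ioo 0 T) →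
      IntegrableOn (fun t => Real.exp (r * t) * u t) (Ioo 0 T) := fun {u} hu => by
    have := ((intervalIntegrable_iff_integrableOn_Ioo_of_le hT.le).2 hu).continuousOn_mul
      hexp.continuous.continuousOn
    exact (intervalIntegrable_iff_integrableOn_Ioo_of_le hT.le).1 this
  -- Testing with `η exp(rt)` shows that `exp(rt) y` has weak derivative `exp(rt) f`.
  obtain ⟨c, hc⟩ := exists_ae_eq_primitive hT (hmul hyI) (hmul hf) fun η hη => by
    have hη' : IsTest 0 T fun t => η t * Real.exp (r * t) := hη.mul hexp
    have hd : ∀ t, deriv (fun t => η t * Real.exp (r * t)) t =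
        deriv η t * Real.exp (r * t) + η t * (r * Real.exp (r * t)) := fun t =>
      ((hη.hasDerivAt t).mul (hasDerivAt_exp_mul r t)).deriv
    have h1 := h _ hη'
    have e1 : ∀ t, Real.exp (r * t) * y t * deriv η t =
        y t * deriv (fun t => η t * Real.exp (r * t)) t
          - r * (y t * (η t * Real.exp (r * t))) := fun t => by rw [hd]; ring
    have e2 : ∀ t, Real.exp (r * t) * f t * η t =
        (f t - r * y t) * (η t * Real.exp (r * t)) + r * (y t * (η t * Real.exp (r * t))) :=
      fun t => by ring
    simp only [e1, e2]
    rw [integral_sub (hη'.deriv.integrable_mul hyI) ((hη'.integrable_mul hyI).const_mul r),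
      integral_add (f := fun t => (f t - r * y t) * (η t * Real.exp (r * t)))
        (hη'.integrable_mul (z := fun t => f t - r * y t) (hf.sub (hyI.const_mul r)))
        ((hη'.integrable_mul hyI).const_mul r), h1]
    ring
  have hfI : IntervalIntegrable (fun t => Real.exp (r * t) * f t) volume 0 T :=
    (intervalIntegrable_iff_integrableOn_Ioo_of_le hT.le).2 (hmul hf)
  rw [Measure.restrict_congr_set Ioo_ae_eq_Icc] at hc
  have hprim := intervalIntegral.continuousOn_primitive_interval' hfI left_mem_uIcc
  rw [uIcc_of_le hT.le] at hprim
  -- Both sides are continuous on `[0, T]`, so the identity holds at every time; at `t = 0` it gives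
  -- the constant.
  have key := Measure.eqOn_Icc_of_ae_eq volume hT.ne hc (hexp.continuous.continuousOn.mul hy)
    (continuousOn_const.add hprim)
  have hc0 : y 0 = c := by simpa using key (left_mem_Icc.2 hT.le)
  intro t ht
  have h1 := key ht
  simp only at h1
  have h2 : Real.exp (-r * t) * Real.exp (r * t) = 1 := by rw [← Real.exp_add]; simp
  calc y t = Real.exp (-r * t) * (Real.exp (r * t) * y t) := by rw [← mul_assoc, h2, one_mul]
    _ = _ := by
      rw [h1, hc0, mul_add, ← intervalIntegral.integral_const_mul]
      congr 2
      funext s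
      rw [← mul_assoc, ← Real.exp_add]
      congr 2
      ring

end Duhamel

/-! ### Estimates for abstract parabolic problems. -/

section Evolution

variable {V H : Type*} [NormedAddCommGroup V] [InnerProductSpace ℝ V]
  [NormedAddCommGroup H] [InnerProductSpace ℝ H]

/-- The functional `φ ↦ (h, jφ)` on `V`. -/
def pairing (j : V →L[ℝ] H) (h : H) : StrongDual ℝ V := (innerSL ℝ h).comp j

@[simp]
theorem pairing_apply (j : V →L[ℝ] H) (h : H) (φ : V) : pairing j h φ = ⟪h, j φ⟫ := rfl

/-- `w` is a weak solution of `w' + a w = F` on `(0,T)`; `W` is `w` as a function with values in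
`V` and `W'` is its derivative. -/
structure IsSolution (T : ℝ) (j : V →L[ℝ] H) (a : V →L[ℝ] V →L[ℝ] ℝ) (F : ℝ → StrongDual ℝ V)
    (w : ℝ → H) (W : ℝ → V) (W' : ℝ → StrongDual ℝ V) : Prop where
  continuousOn : ContinuousOn w (Icc 0 T)
  ae_eq : ∀ᵐ t ∂volume.restrict (Ioo 0 T), j (W t) = w t
  inL2 : InL2 T W
  inL2' : InL2 T W'
  weak : ∀ η : ℝ → ℝ, IsTest 0 T η →
    ∫ t in Ioo 0 T, deriv η t • pairing j (j (W t)) = -∫ t in Ioo 0 T, η t • W' t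
  eq : ∀ᵐ t ∂volume.restrict (Ioo 0 T), W' t + a (W t) = F t

variable {T : ℝ} {j : V →L[ℝ] H} {a : V →L[ℝ] V →L[ℝ] ℝ} {ι : Type*}

theorem _root_.ContinuousLinearMap.inL2_comp {E F : Type*} [NormedAddCommGroup E]
    [NormedSpace ℝ E] [NormedAddCommGroup F] [NormedSpace ℝ F] (L : E →L[ℝ] F) {f : ℝ → E}
    (hf : InL2 T f) : InL2 T fun t => L (f t) :=
  L.comp_memLp' hf

theorem InL2.integrable {E : Type*} [NormedAddCommGroup E] {f : ℝ → E} (hf : InL2 T f) :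
    IntegrableOn f (Ioo 0 T) :=
  MemLp.integrable (by norm_num) hf

theorem IsTest.integrable_smul {E : Type*} [NormedAddCommGroup E] [NormedSpace ℝ E] {a b : ℝ}
    {z : ℝ → E} {η : ℝ → ℝ} (hz : IntegrableOn z (Ioo a b)) (hη : IsTest a b η) :
    IntegrableOn (fun t => η t • z t) (Ioo a b) := by
  obtain ⟨C, hC⟩ := hη.compact.exists_bound_of_continuous hη.continuous
  exact hz.bdd_smul C hη.continuous.aestronglyMeasurable (Eventually.of_forall hC)

/-- Exhibits the pairing as a continuous linear map in `h`, from which linearity and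
square-integrability in time follow. -/
theorem pairing_eq (j : V →L[ℝ] H) (h : H) :
    pairing j h = ((ContinuousLinearMap.compL ℝ V H ℝ).flip j).comp (innerSL ℝ : H →L[ℝ] _) h :=
  rfl

theorem pairing_sub (j : V →L[ℝ] H) (h k : H) : pairing j (h - k) = pairing j h - pairing j k := by
  rw [pairing_eq, map_sub, ← pairing_eq, ← pairing_eq]

theorem InL2.pairing {f : ℝ → H} (hf : InL2 T f) (j : V →L[ℝ] H) :
    InL2 T fun t => pairing j (f t) := by
  simp only [pairing_eq]
  exact ContinuousLinearMap.inL2_comp _ hf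

theorem IsSolution.inL2_rhs {F : ℝ → StrongDual ℝ V} {w : ℝ → H} {W : ℝ → V}
    {W' : ℝ → StrongDual ℝ V} (h : IsSolution T j a F w W W') : InL2 T F :=
  (h.inL2'.add (a.inL2_comp h.inL2)).ae_eq h.eq

namespace EigenSystem

variable (S : EigenSystem j a ι)
include S

theorem form_eq_zero {φ : V} (h : ∀ i, a (S.vec i) φ = 0) : j φ = 0 := by
  have h0 : ∀ i, ⟪S.basis i, j φ⟫ = 0 := fun i => by
    have := h i
    rw [S.form_vec] at this
    exact (mul_eq_zero.1 this).resolve_left (S.val_pos i).ne'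
  refine S.basis.repr.injective ?_
  ext i
  simp [S.basis.repr_apply_apply, h0]

/-- Represent `F` as `a g` with `g ∈ V`: then all coefficients of `j g` vanish, so `g = 0`.
Identities in `V*` can therefore be checked on eigenvectors. -/
theorem functional_eq_zero [CompleteSpace V] (hs : ∀ v w, a v w = a w v) (hc : IsCoercive a)
    (hinj : Function.Injective j) {F : StrongDual ℝ V} (h : ∀ i, F (S.vec i) = 0) : F = 0 := by
  obtain ⟨G, hG⟩ := hc.exists_solutionOperator (ContinuousLinearMap.id ℝ V)
  have hF : ∀ φ, a (G ((InnerProductSpace.toDual ℝ V).symm F)) φ = F φ := fun φ => by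
    rw [hG]
    simp
  have h0 : j (G ((InnerProductSpace.toDual ℝ V).symm F)) = 0 :=
    S.form_eq_zero fun i => by rw [hs, hF, h]
  have h1 := hinj (h0.trans (map_zero j).symm)
  ext φ
  rw [← hF, h1]
  simp

theorem hasSum_sq (h : H) : HasSum (fun i => ⟪S.basis i, h⟫ ^ 2) (‖h‖ ^ 2) := by
  have := S.basis.hasSum_inner_mul_inner h h
  rw [real_inner_self_eq_norm_sq] at this
  refine this.congr_fun fun i => ?_
  rw [real_inner_comm (S.basis i) h, sq]

theorem sum_sq_le (h : H) (s : Finset ι) : ∑ i ∈ s, ⟪S.basis i, h⟫ ^ 2 ≤ ‖h‖ ^ 2 :=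
  sum_le_hasSum s (fun _ _ => sq_nonneg _) (S.hasSum_sq h)

theorem norm_sq_le {h : H} {M : ℝ} (hM : ∀ s : Finset ι, ∑ i ∈ s, ⟪S.basis i, h⟫ ^ 2 ≤ M) :
    ‖h‖ ^ 2 ≤ M :=
  hasSum_le_of_sum_le (S.hasSum_sq h) hM

/-- The eigenvectors are orthogonal for `a` as well, with `a(e_i, e_i) = λ_i`. -/
theorem form_sum (s : Finset ι) (c : ι → ℝ) :
    a (∑ i ∈ s, c i • S.vec i) (∑ i ∈ s, c i • S.vec i) = ∑ i ∈ s, S.val i * c i ^ 2 := by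
  classical
  rw [map_sum a, _root_.sum_apply]
  refine Finset.sum_congr rfl fun i hi => ?_
  rw [map_smul, smul_apply, S.form_vec, map_sum, inner_sum, Finset.sum_eq_single i]
  · rw [map_smul, inner_smul_right, S.map_vec, real_inner_self_eq_norm_sq,
      S.basis.orthonormal.1 i, smul_eq_mul]
    ring
  · intro k _ hk
    rw [map_smul, inner_smul_right, S.map_vec, S.basis.orthonormal.2 hk.symm, mul_zero]
  · exact fun h => absurd hi h

/-- The dual norm of a functional controls its coefficients. -/
theorem sum_functional_sq_le {c : ℝ} (hc0 : 0 < c) (hc : ∀ v, c * ‖v‖ ^ 2 ≤ a v v)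
    (F : StrongDual ℝ V) (s : Finset ι) :
    ∑ i ∈ s, (S.val i)⁻¹ * F (S.vec i) ^ 2 ≤ c⁻¹ * ‖F‖ ^ 2 := by
  -- The truncated representative of `F` with respect to `a`, chosen so that `F φ = a φ φ = Q`. Then
  -- `Q ≤ ‖F‖ ‖φ‖` and `c ‖φ‖² ≤ Q` combine to `c Q ≤ ‖F‖²`.
  set φ := ∑ i ∈ s, ((S.val i)⁻¹ * F (S.vec i)) • S.vec i with hφ
  set Q := ∑ i ∈ s, (S.val i)⁻¹ * F (S.vec i) ^ 2 with hQ
  have h1 : F φ = Q := by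
    rw [hφ, map_sum]
    refine Finset.sum_congr rfl fun i _ => ?_
    rw [map_smul, smul_eq_mul]
    ring
  have h2 : a φ φ = Q := by
    rw [hφ, S.form_sum]
    refine Finset.sum_congr rfl fun i _ => ?_
    have := (S.val_pos i).ne'
    field_simp
  have h3 := hc φ
  have h4 : Q ≤ ‖F‖ * ‖φ‖ := by
    rw [← h1]
    exact (le_abs_self _).trans (F.le_opNorm φ)
  rw [h2] at h3
  have h5 : c * Q ≤ ‖F‖ ^ 2 := by nlinarith [sq_nonneg (‖F‖ - c * ‖φ‖)]
  rwa [inv_mul_eq_div, le_div_iff₀' hc0]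

/-- An element of `H` with finite energy comes from `V`. -/
theorem exists_lift [CompleteSpace V] {c : ℝ} (hc0 : 0 < c) (hc : ∀ v, c * ‖v‖ ^ 2 ≤ a v v)
    {h : H} {M : ℝ}
    (hM : ∀ s : Finset ι, ∑ i ∈ s, S.val i * ⟪S.basis i, h⟫ ^ 2 ≤ M) :
    ∃ φ, HasSum (fun i => ⟪S.basis i, h⟫ • S.vec i) φ ∧ j φ = h ∧ c * ‖φ‖ ^ 2 ≤ M := by
  have hsum : Summable fun i => S.val i * ⟪S.basis i, h⟫ ^ 2 :=
    summable_of_sum_le (fun i => mul_nonneg (S.val_pos i).le (sq_nonneg _)) hM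
  have hle : ∀ s : Finset ι, c * ‖∑ i ∈ s, ⟪S.basis i, h⟫ • S.vec i‖ ^ 2 ≤
      ∑ i ∈ s, S.val i * ⟪S.basis i, h⟫ ^ 2 := fun s => by
    rw [← S.form_sum]; exact hc _
  -- By coercivity the norm of a partial sum in `V` is bounded by its energy, so small energy tails
  -- give the Cauchy property.
  have hV : Summable fun i => ⟪S.basis i, h⟫ • S.vec i := by
    rw [summable_iff_vanishing_norm] at hsum ⊢
    intro ε hε
    obtain ⟨s, hs⟩ := hsum (c * ε ^ 2) (by positivity)
    refine ⟨s, fun t ht => ?_⟩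
    have h1 := (hle t).trans_lt ((le_abs_self _).trans_lt (hs t ht))
    exact lt_of_pow_lt_pow_left₀ 2 hε.le (lt_of_mul_lt_mul_left h1 hc0.le)
  obtain ⟨φ, hφ⟩ := hV
  refine ⟨φ, hφ, ?_, ?_⟩
  · have h1 := hφ.mapL j
    simp only [map_smul, S.map_vec] at h1
    have h2 := S.basis.hasSum_repr h
    simp only [S.basis.repr_apply_apply] at h2
    exact h1.unique h2
  · exact le_of_tendsto (((hφ.norm).pow 2).const_mul c)
      (Eventually.of_forall fun s => (hle s).trans (hM s))

/-- Evaluate the weak equation at the `i`-th eigenvector: by symmetry the form contributes `λ_i`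
times the `i`-th coefficient, which leaves a scalar equation. -/
theorem duhamel (hT : 0 < T) (hs : ∀ v w, a v w = a w v) {F : ℝ → StrongDual ℝ V} {w : ℝ → H}
    {W : ℝ → V} {W' : ℝ → StrongDual ℝ V} (h : IsSolution T j a F w W W') (i : ι) {t : ℝ}
    (ht : t ∈ Icc 0 T) :
    ⟪S.basis i, w t⟫ = Real.exp (-S.val i * t) * ⟪S.basis i, w 0⟫ +
      ∫ s in 0..t, Real.exp (-S.val i * (t - s)) * F s (S.vec i) := by
  have hF : InL2 T fun t => F t (S.vec i) :=
    (ContinuousLinearMap.apply ℝ ℝ (S.vec i)).inL2_comp h.inL2_rhs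
  refine eq_duhamel_of_weak hT (y := fun t => ⟪S.basis i, w t⟫) (f := fun t => F t (S.vec i))
    (continuousOn_const.inner h.continuousOn) hF.integrable (fun η hη => ?_) t ht
  have h1 := congrArg (fun L : StrongDual ℝ V => L (S.vec i)) (h.weak η hη)
  have hp : InL2 T fun t => pairing j (j (W t)) := InL2.pairing (j.inL2_comp h.inL2) j
  simp only [neg_apply] at h1
  rw [ContinuousLinearMap.integral_apply (hη.deriv.integrable_smul hp.integrable),
    ContinuousLinearMap.integral_apply (hη.integrable_smul h.inL2'.integrable)] at h1
  convert h1 using 1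
  · refine integral_congr_ae ?_
    filter_upwards [h.ae_eq] with t ht
    simp [ht, S.map_vec, real_inner_comm, mul_comm]
  · congr 1
    refine integral_congr_ae ?_
    filter_upwards [h.ae_eq, h.eq] with t ht he
    rw [← he, ← ht, ← S.form_vec, hs (S.vec i)]
    simp [mul_comm]

/-- Two solutions with the same initial value are as close as their right-hand sides. -/
theorem norm_sub_sq_le (hT : 0 < T) (hs : ∀ v w, a v w = a w v) {c : ℝ} (hc0 : 0 < c)
    (hc : ∀ v, c * ‖v‖ ^ 2 ≤ a v v) {F₁ F₂ : ℝ → StrongDual ℝ V} {w₁ w₂ : ℝ → H}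
    {W₁ W₂ : ℝ → V} {W₁' W₂' : ℝ → StrongDual ℝ V} (h₁ : IsSolution T j a F₁ w₁ W₁ W₁')
    (h₂ : IsSolution T j a F₂ w₂ W₂ W₂') (h0 : w₁ 0 = w₂ 0) {t : ℝ} (ht : t ∈ Icc 0 T) :
    ‖w₁ t - w₂ t‖ ^ 2 ≤ c⁻¹ * ∫ s in Ioo 0 T, ‖F₁ s - F₂ s‖ ^ 2 := by
  have hF : InL2 T fun s => F₁ s - F₂ s := h₁.inL2_rhs.sub h₂.inL2_rhs
  have hFi : ∀ (i : ι), InL2 T fun s => (F₁ s - F₂ s) (S.vec i) := fun i =>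
    (ContinuousLinearMap.apply ℝ ℝ (S.vec i)).inL2_comp hF
  refine S.norm_sq_le fun s => ?_
  -- The initial terms cancel, and Duhamel's gain supplies the weight `λ_i⁻¹` with which
  -- `sum_functional_sq_le` recovers the dual norm.
  have hi : ∀ i, ⟪S.basis i, w₁ t - w₂ t⟫ ^ 2 ≤
      ∫ s in Ioo 0 T, (S.val i)⁻¹ * ((F₁ s - F₂ s) (S.vec i)) ^ 2 := fun i => by
    have hI : ∀ {F : ℝ → StrongDual ℝ V}, InL2 T F → IntervalIntegrable
        (fun s => Real.exp (-S.val i * (t - s)) * F s (S.vec i)) volume 0 t := fun {F} hF => by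
      have : InL2 T fun t => F t (S.vec i) :=
        (ContinuousLinearMap.apply ℝ ℝ (S.vec i)).inL2_comp hF
      refine IntervalIntegrable.continuousOn_mul ?_ (by fun_prop)
      exact (intervalIntegrable_iff_integrableOn_Ioo_of_le ht.1).2
        (this.integrable.mono_set (Ioo_subset_Ioo_right ht.2))
    have h3 : ⟪S.basis i, w₁ t - w₂ t⟫ =
        ∫ s in 0..t, Real.exp (-S.val i * (t - s)) * (F₁ s - F₂ s) (S.vec i) := by
      rw [inner_sub_right, S.duhamel hT hs h₁ i ht, S.duhamel hT hs h₂ i ht, h0,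
        add_sub_add_left_eq_sub, ← intervalIntegral.integral_sub (hI h₁.inL2_rhs) (hI h₂.inL2_rhs)]
      simp only [sub_apply, mul_sub]
    have h4 := mul_sq_duhamel_le (S.val_pos i) ht (hFi i)
    rw [h3, integral_const_mul, inv_mul_eq_div, le_div_iff₀' (S.val_pos i)]
    refine le_trans ?_ h4
    have := S.val_pos i
    have h5 := sq_nonneg (∫ s in 0..t, Real.exp (-S.val i * (t - s)) * (F₁ s - F₂ s) (S.vec i))
    nlinarith [mul_nonneg this.le h5]
  calc _ ≤ ∑ i ∈ s, ∫ s in Ioo 0 T, (S.val i)⁻¹ * ((F₁ s - F₂ s) (S.vec i)) ^ 2 :=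
        Finset.sum_le_sum fun i _ => hi i
    _ = ∫ t in Ioo 0 T, ∑ i ∈ s, (S.val i)⁻¹ * ((F₁ t - F₂ t) (S.vec i)) ^ 2 :=
        (integral_finsetSum _ fun i _ => (hFi i).integrable_sq.const_mul _).symm
    _ ≤ ∫ t in Ioo 0 T, c⁻¹ * ‖F₁ t - F₂ t‖ ^ 2 := by
        refine integral_mono (integrable_finsetSum _ fun i _ =>
          (hFi i).integrable_sq.const_mul _) (hF.integrable_norm_pow'.const_mul _) fun t => ?_
        exact S.sum_functional_sq_le hc0 hc _ s
    _ = _ := integral_const_mul _ _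

/-- Parabolic smoothing: the energy `∑ λ_i ⟪e_i, w(T)⟫²` is finite, because the exponential decay
absorbs `λ_i` in the initial term and Duhamel's gain absorbs it in the source term. The form enters
the bound only through `c`. -/
theorem exists_lift_final [CompleteSpace V] (hT : 0 < T) (hs : ∀ v w, a v w = a w v)
    {c : ℝ} (hc0 : 0 < c) (hc : ∀ v, c * ‖v‖ ^ 2 ≤ a v v) {f : ℝ → H} (hf : InL2 T f) {w : ℝ → H}
    {W : ℝ → V} {W' : ℝ → StrongDual ℝ V}
    (h : IsSolution T j a (fun t => pairing j (f t)) w W W') :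
    ∃ φ, j φ = w T ∧ c * ‖φ‖ ^ 2 ≤ T⁻¹ * ‖w 0‖ ^ 2 + ∫ s in Ioo 0 T, ‖f s‖ ^ 2 := by
  have hfi : ∀ i : ι, InL2 T fun s => ⟪S.basis i, f s⟫ := fun i =>
    (innerSL ℝ (S.basis i)).inL2_comp hf
  have hterm : ∀ i, S.val i * ⟪S.basis i, w T⟫ ^ 2 ≤
      T⁻¹ * ⟪S.basis i, w 0⟫ ^ 2 + ∫ s in Ioo 0 T, ⟪S.basis i, f s⟫ ^ 2 := fun i => by
    have h1 := S.duhamel hT hs h i (right_mem_Icc.2 hT.le)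
    simp only [pairing_apply, S.map_vec, real_inner_comm (S.basis i)] at h1
    have h2 := mul_sq_duhamel_le (S.val_pos i) (right_mem_Icc.2 hT.le) (hfi i)
    have hl := S.val_pos i
    rw [h1]
    set q := ∫ s in 0..T, Real.exp (-S.val i * (T - s)) * ⟪S.basis i, f s⟫
    set E := Real.exp (-S.val i * T)
    -- This is `x exp(-x) ≤ 1` at `x = 2 λ_i T`.
    have hE : 2 * S.val i * E ^ 2 ≤ T⁻¹ := by
      have h3 : E ^ 2 = Real.exp (-(2 * S.val i * T)) := by
        rw [← Real.exp_nat_mul]; congr 1; push_cast; ring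
      have h4 := Real.add_one_le_exp (2 * S.val i * T)
      have h5 : Real.exp (-(2 * S.val i * T)) * Real.exp (2 * S.val i * T) = 1 := by
        rw [← Real.exp_add]; simp
      rw [h3, ← one_div, le_div_iff₀ hT]
      nlinarith [Real.exp_pos (-(2 * S.val i * T))]
    have h6 : (E * ⟪S.basis i, w 0⟫ + q) ^ 2 ≤ 2 * (E * ⟪S.basis i, w 0⟫) ^ 2 + 2 * q ^ 2 := by
      nlinarith [sq_nonneg (E * ⟪S.basis i, w 0⟫ - q)]
    calc _ ≤ S.val i * (2 * (E * ⟪S.basis i, w 0⟫) ^ 2 + 2 * q ^ 2) := by gcongr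
      _ = 2 * S.val i * E ^ 2 * ⟪S.basis i, w 0⟫ ^ 2 + 2 * S.val i * q ^ 2 := by ring
      _ ≤ _ := by gcongr
  obtain ⟨φ, -, h1, h2⟩ := S.exists_lift hc0 hc (h := w T)
    (M := T⁻¹ * ‖w 0‖ ^ 2 + ∫ s in Ioo 0 T, ‖f s‖ ^ 2) fun s => by
      calc _ ≤ ∑ i ∈ s, (T⁻¹ * ⟪S.basis i, w 0⟫ ^ 2 + ∫ s in Ioo 0 T, ⟪S.basis i, f s⟫ ^ 2) :=
            Finset.sum_le_sum fun i _ => hterm i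
        _ = T⁻¹ * ∑ i ∈ s, ⟪S.basis i, w 0⟫ ^ 2 +
            ∫ t in Ioo 0 T, ∑ i ∈ s, ⟪S.basis i, f t⟫ ^ 2 := by
          rw [Finset.sum_add_distrib, ← Finset.mul_sum,
            integral_finsetSum _ fun i _ => (hfi i).integrable_sq]
        _ ≤ _ := by
          refine add_le_add (mul_le_mul_of_nonneg_left (S.sum_sq_le _ s) (inv_nonneg.2 hT.le)) ?_
          exact integral_mono (integrable_finsetSum _ fun i _ => (hfi i).integrable_sq)
            hf.integrable_norm_pow' fun t => S.sum_sq_le _ s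
  exact ⟨φ, h1, h2⟩

end EigenSystem

end Evolution

/-! ### Existence by eigenvector expansion. -/

section Existence

variable {V H : Type*} [NormedAddCommGroup V] [InnerProductSpace ℝ V] [CompleteSpace V]
  [NormedAddCommGroup H] [InnerProductSpace ℝ H] [CompleteSpace H]
  {T : ℝ} {j : V →L[ℝ] H} {a : V →L[ℝ] V →L[ℝ] ℝ} {ι : Type*}

/-- The solution of `y' + r y = f`, `y(0) = p`. -/
def expSol (r p : ℝ) (f : ℝ → ℝ) (t : ℝ) : ℝ :=
  Real.exp (-r * t) * (p + ∫ s in 0..t, Real.exp (r * s) * f s)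

theorem expSol_zero (r p : ℝ) (f : ℝ → ℝ) : expSol r p f 0 = p := by simp [expSol]

theorem hasDerivAt_expSol (r p : ℝ) {f : ℝ → ℝ} (hf : Continuous f) (t : ℝ) :
    HasDerivAt (expSol r p f) (f t - r * expSol r p f t) t := by
  have hc : Continuous fun s => Real.exp (r * s) * f s := by fun_prop
  have h1 := (intervalIntegral.integral_hasDerivAt_right (hc.intervalIntegrable 0 t)
    (hc.stronglyMeasurableAtFilter _ _) hc.continuousAt).const_add p
  refine ((hasDerivAt_exp_mul (-r) t).mul h1).congr_deriv ?_
  have h2 : Real.exp (-r * t) * Real.exp (r * t) = 1 := by rw [← Real.exp_add]; simp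
  rw [← mul_assoc (Real.exp (-r * t)), h2, expSol]
  ring

theorem continuous_expSol (r p : ℝ) {f : ℝ → ℝ} (hf : Continuous f) :
    Continuous (expSol r p f) :=
  continuous_iff_continuousAt.2 fun t => (hasDerivAt_expSol r p hf t).continuousAt

/-- Multiply the equation by `2y` and use `2 y f ≤ r y² + r⁻¹ f²`; the defect is the square `r⁻¹ (f
- r y)²`. -/
theorem expSol_energy {r : ℝ} (hr : 0 < r) (p : ℝ) {f : ℝ → ℝ} (hf : Continuous f) {t : ℝ}
    (ht : t ∈ Icc 0 T) :
    expSol r p f t ^ 2 + ∫ s in 0..t, r * expSol r p f s ^ 2 ≤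
      p ^ 2 + ∫ s in Ioo 0 T, r⁻¹ * f s ^ 2 := by
  set y := expSol r p f with hy
  have hyc : Continuous y := continuous_expSol r p hf
  have h1 : ∫ s in 0..t, 2 * y s * (f s - r * y s) = y t ^ 2 - p ^ 2 := by
    have hd : ∀ s, HasDerivAt (fun s => y s ^ 2) (2 * y s * (f s - r * y s)) s := fun s => by
      simpa using (hasDerivAt_expSol r p hf s).fun_pow 2
    rw [intervalIntegral.integral_eq_sub_of_hasDerivAt (fun s _ => hd s)
      ((by fun_prop : Continuous fun s => 2 * y s * (f s - r * y s)).intervalIntegrable 0 t),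
      hy, expSol_zero]
  have h2 : ∫ s in 0..t, (2 * y s * (f s - r * y s) + r * y s ^ 2) ≤
      ∫ s in 0..t, r⁻¹ * f s ^ 2 := by
    refine intervalIntegral.integral_mono_on ht.1
      ((by fun_prop : Continuous fun s => 2 * y s * (f s - r * y s) + r * y s ^ 2).intervalIntegrable 0 t)
      ((by fun_prop : Continuous fun s => r⁻¹ * f s ^ 2).intervalIntegrable 0 t) fun s _ => ?_
    have h3 : r⁻¹ * f s ^ 2 - (2 * y s * (f s - r * y s) + r * y s ^ 2) =
        r⁻¹ * (f s - r * y s) ^ 2 := by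
      field_simp
      ring
    have h4 : 0 ≤ r⁻¹ * (f s - r * y s) ^ 2 := by positivity
    linarith
  rw [intervalIntegral.integral_add
    ((by fun_prop : Continuous fun s => 2 * y s * (f s - r * y s)).intervalIntegrable 0 t)
    ((by fun_prop : Continuous fun s => r * y s ^ 2).intervalIntegrable 0 t), h1] at h2
  have h5 : ∫ s in 0..t, r⁻¹ * f s ^ 2 ≤ ∫ s in Ioo 0 T, r⁻¹ * f s ^ 2 := by
    rw [← integral_Ioo_eq_intervalIntegral ht.1]
    refine setIntegral_mono_set ?_ (Eventually.of_forall fun _ => by positivity)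
      (Ioo_subset_Ioo_right ht.2).eventuallyLE
    exact (by fun_prop : Continuous fun s => r⁻¹ * f s ^ 2).integrableOn_Ioc.mono_set
      Ioo_subset_Ioc_self
  linarith

namespace EigenSystem

variable (S : EigenSystem j a ι)
include S

/-- Solve for each coefficient and sum. The energy bounds `N i` control both `sup y_i²` and `∫ λ_i
y_i²`; since they are summable, the series converges uniformly in time in `H` and, for a.e. time, in
`V`. -/
theorem exists_isSolution [Countable ι] (hT : 0 < T) (hs : ∀ v w, a v w = a w v) {c : ℝ}
    (hc0 : 0 < c) (hc : ∀ v, c * ‖v‖ ^ 2 ≤ a v v) (hinj : Function.Injective j) (u₀ : H)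
    {f : ℝ → H} (hf : Continuous f) :
    ∃ w W W', Continuous w ∧ w 0 = u₀ ∧
      IsSolution T j a (fun t => pairing j (f t)) w W W' := by
  have hcoer : IsCoercive a := ⟨c, hc0, fun u => by
    have := hc u
    rwa [sq, ← mul_assoc] at this⟩
  set y : ι → ℝ → ℝ := fun i => expSol (S.val i) ⟪S.basis i, u₀⟫ (fun t => ⟪S.basis i, f t⟫) with hy
  have hfi : ∀ i, Continuous fun t => ⟪S.basis i, f t⟫ := fun i => by fun_prop
  have hyd : ∀ i t, HasDerivAt (y i) (⟪S.basis i, f t⟫ - S.val i * y i t) t := fun i t =>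
    hasDerivAt_expSol _ _ (hfi i) t
  have hyc : ∀ i, Continuous (y i) := fun i => continuous_expSol _ _ (hfi i)
  set N : ι → ℝ := fun i =>
    ⟪S.basis i, u₀⟫ ^ 2 + ∫ s in Ioo 0 T, (S.val i)⁻¹ * ⟪S.basis i, f s⟫ ^ 2 with hN
  have hfL : InL2 T f := memLp_of_continuousOn hf.continuousOn
  have hN0 : ∀ i, 0 ≤ N i := fun i => by
    have := S.val_pos i
    have : 0 ≤ ∫ s in Ioo 0 T, (S.val i)⁻¹ * ⟪S.basis i, f s⟫ ^ 2 :=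
      integral_nonneg fun _ => by positivity
    positivity
  have hNs : Summable N := by
    have hpL : InL2 T fun t => pairing j (f t) := hfL.pairing j
    refine summable_of_sum_le hN0 (c := ‖u₀‖ ^ 2 + ∫ s in Ioo 0 T, c⁻¹ * ‖pairing j (f s)‖ ^ 2)
      fun s => ?_
    have hi : ∀ i ∈ s, Integrable (fun t => (S.val i)⁻¹ * ⟪S.basis i, f t⟫ ^ 2)
        (volume.restrict (Ioo 0 T)) := fun i _ =>
      (((innerSL ℝ (S.basis i)).inL2_comp hfL).integrable_sq).const_mul _
    rw [hN, Finset.sum_add_distrib, ← integral_finsetSum _ hi]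
    refine add_le_add (S.sum_sq_le _ s) (integral_mono (integrable_finsetSum _ hi)
      (hpL.integrable_norm_pow'.const_mul _) fun t => ?_)
    have := S.sum_functional_sq_le hc0 hc (pairing j (f t)) s
    simpa only [pairing_apply, S.map_vec, real_inner_comm (S.basis _)] using this
  have hen : ∀ i, ∀ t ∈ Icc 0 T,
      y i t ^ 2 + ∫ s in 0..t, S.val i * y i s ^ 2 ≤ N i := fun i t ht =>
    expSol_energy (S.val_pos i) _ (hfi i) ht
  have hyN : ∀ i, ∀ t ∈ Icc 0 T, y i t ^ 2 ≤ N i := fun i t ht => by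
    have h1 := hen i t ht
    have h2 : 0 ≤ ∫ s in 0..t, S.val i * y i s ^ 2 :=
      intervalIntegral.integral_nonneg ht.1 fun s _ =>
        mul_nonneg (S.val_pos i).le (sq_nonneg _)
    linarith
  have hyE : ∀ i, ∫ s in Ioo 0 T, S.val i * y i s ^ 2 ≤ N i := fun i => by
    have h1 := hen i T (right_mem_Icc.2 hT.le)
    rw [integral_Ioo_eq_intervalIntegral hT.le]
    nlinarith [sq_nonneg (y i T)]
  -- the solution as a continuous function with values in `H`
  let g : ι → C(Icc (0 : ℝ) T, H) := fun i =>
    ⟨fun t => y i t • S.basis i, by have := hyc i; fun_prop⟩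
  have hg : Summable g := by
    rw [summable_iff_vanishing_norm] at hNs ⊢
    intro ε hε
    obtain ⟨s, hs⟩ := hNs (ε ^ 2) (by positivity)
    refine ⟨s, fun t ht => ?_⟩
    rw [ContinuousMap.norm_lt_iff _ hε]
    intro x
    refine lt_of_pow_lt_pow_left₀ 2 hε.le ?_
    have h1 : ‖(∑ i ∈ t, g i) x‖ ^ 2 = ∑ i ∈ t, y i x ^ 2 := by
      rw [ContinuousMap.sum_apply, ← real_inner_self_eq_norm_sq]
      change ⟪∑ i ∈ t, y i x • S.basis i, ∑ i ∈ t, y i x • S.basis i⟫ = _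
      rw [S.basis.orthonormal.inner_sum]
      simp [sq]
    rw [h1]
    exact (Finset.sum_le_sum fun i _ => hyN i x x.2).trans_lt
      ((le_abs_self _).trans_lt (hs t ht))
  set w : ℝ → H := IccExtend hT.le (∑' i, g i : C(Icc (0 : ℝ) T, H)) with hw
  have hws : ∀ t ∈ Icc 0 T, HasSum (fun i => y i t • S.basis i) (w t) := fun t ht => by
    have h1 := hg.hasSum.mapL (ContinuousMap.evalCLM ℝ (⟨t, ht⟩ : Icc (0 : ℝ) T))
    rw [hw, IccExtend_of_mem hT.le _ ht]
    exact h1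
  have hwc : Continuous w := (ContinuousMap.continuous _).Icc_extend'
  have hcoef : ∀ t ∈ Icc 0 T, ∀ i, ⟪S.basis i, w t⟫ = y i t := fun t ht i => by
    have h1 := (hws t ht).mapL (innerSL ℝ (S.basis i))
    refine (h1.unique (hasSum_single i fun k hk => ?_)).trans ?_
    · simp [S.basis.orthonormal.2 hk.symm]
    · simp [S.basis.orthonormal.1 i]
  have hw0 : w 0 = u₀ := by
    refine (hws 0 (left_mem_Icc.2 hT.le)).unique ?_
    have h2 := S.basis.hasSum_repr u₀
    simpa only [S.basis.repr_apply_apply, hy, expSol_zero] using h2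
  -- the solution with values in `V`
  set M : ℝ → ENNReal := fun t => ∑' i, ENNReal.ofReal (S.val i * y i t ^ 2) with hM
  have hMm : ∀ i, Measurable fun t => ENNReal.ofReal (S.val i * y i t ^ 2) := fun i => by
    have := hyc i
    exact (by fun_prop : Continuous fun t => S.val i * y i t ^ 2).measurable.ennreal_ofReal
  have hMI : ∫⁻ t in Ioo 0 T, M t ≠ ⊤ := by
    rw [hM, lintegral_tsum fun i => (hMm i).aemeasurable]
    refine ne_top_of_le_ne_top hNs.tsum_ofReal_ne_top (ENNReal.tsum_le_tsum fun i => ?_)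
    rw [← ofReal_integral_eq_lintegral_ofReal]
    · exact ENNReal.ofReal_le_ofReal (hyE i)
    · have := hyc i
      exact (by fun_prop : Continuous fun t => S.val i * y i t ^ 2).integrableOn_Ioc.mono_set
        Ioo_subset_Ioc_self
    · exact Eventually.of_forall fun t => mul_nonneg (S.val_pos i).le (sq_nonneg _)
  have hMmeas : Measurable M := Measurable.tsum hMm
  have hMfin : ∀ᵐ t ∂volume.restrict (Ioo 0 T), M t < ⊤ := ae_lt_top hMmeas hMI
  -- At the exceptional times of infinite energy the value of `W` plays no role; they form a null
  -- set.
  set W : ℝ → V := fun t => ∑' i, y i t • S.vec i with hW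
  have hWs : ∀ᵐ t ∂volume.restrict (Ioo 0 T), HasSum (fun i => y i t • S.vec i) (W t) ∧
      j (W t) = w t ∧ c * ‖W t‖ ^ 2 ≤ (M t).toReal := by
    filter_upwards [hMfin, ae_restrict_mem measurableSet_Ioo] with t ht htm
    have htI := Ioo_subset_Icc_self htm
    obtain ⟨φ, h1, h2, h3⟩ := S.exists_lift hc0 hc (h := w t) (M := (M t).toReal) fun s => by
      have h4 : ENNReal.ofReal (∑ i ∈ s, S.val i * y i t ^ 2) ≤ M t := by
        rw [ENNReal.ofReal_sum_of_nonneg fun i _ => mul_nonneg (S.val_pos i).le (sq_nonneg _)]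
        exact ENNReal.sum_le_tsum s
      simp only [hcoef t htI]
      exact (ENNReal.ofReal_le_iff_le_toReal ht.ne).1 h4
    simp only [hcoef t htI] at h1
    have h5 : W t = φ := h1.tsum_eq
    rw [h5]
    exact ⟨h1, h2, h3⟩
  have hWm : AEStronglyMeasurable W (volume.restrict (Ioo 0 T)) := by
    refine aestronglyMeasurable_of_tendsto_ae (u := (atTop : Filter (Finset ι)))
      (f := fun s t => ∑ i ∈ s, y i t • S.vec i) (fun s => ?_) ?_
    · have := hyc
      exact (by fun_prop : Continuous fun t => ∑ i ∈ s, y i t • S.vec i).aestronglyMeasurable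
    · filter_upwards [hWs] with t ht using ht.1
  have hWL : InL2 T W := by
    refine (memLp_two_iff_integrable_sq_norm hWm).2 ?_
    refine Integrable.mono' ((integrable_toReal_of_lintegral_ne_top hMmeas.aemeasurable
      hMI).const_mul c⁻¹) (hWm.norm.pow 2) ?_
    filter_upwards [hWs] with t ht
    rw [Real.norm_of_nonneg (sq_nonneg _), inv_mul_eq_div, le_div_iff₀' hc0]
    exact ht.2.2
  -- Defined by the equation, so that what remains is to show that it is the weak time derivative.
  set W' : ℝ → StrongDual ℝ V := fun t => pairing j (f t) - a (W t) with hW'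
  have hWL' : InL2 T W' := (hfL.pairing j).sub (a.inL2_comp hWL)
  have hp : InL2 T fun t => pairing j (j (W t)) := InL2.pairing (j.inL2_comp hWL) j
  refine ⟨w, W, W', hwc, hw0, hwc.continuousOn, hWs.mono fun t ht => ht.2.1, hWL, hWL', ?_,
    Eventually.of_forall fun t => sub_add_cancel _ _⟩
  intro η hη
  rw [← sub_eq_zero]
  -- On an eigenvector the identity becomes `∫ (η y_i)' = 0`.
  refine S.functional_eq_zero hs hcoer hinj fun i => ?_
  simp only [sub_apply, neg_apply]
  rw [ContinuousLinearMap.integral_apply (hη.deriv.integrable_smul hp.integrable),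
    ContinuousLinearMap.integral_apply (hη.integrable_smul hWL'.integrable), sub_neg_eq_add]
  have hc1 := hη.continuous_deriv
  have hc2 := hη.continuous
  have hc3 := hyc i
  have hc4 := hfi i
  have e1 : ∫ t in Ioo 0 T, (deriv η t • pairing j (j (W t))) (S.vec i) =
      ∫ t in Ioo 0 T, deriv η t * y i t := by
    refine integral_congr_ae ?_
    filter_upwards [hWs, ae_restrict_mem measurableSet_Ioo] with t ht htm
    rw [smul_apply, pairing_apply, ht.2.1, S.map_vec, real_inner_comm,
      hcoef t (Ioo_subset_Icc_self htm), smul_eq_mul]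
  have e2 : ∫ t in Ioo 0 T, (η t • W' t) (S.vec i) =
      ∫ t in Ioo 0 T, η t * (⟪S.basis i, f t⟫ - S.val i * y i t) := by
    refine integral_congr_ae ?_
    filter_upwards [hWs, ae_restrict_mem measurableSet_Ioo] with t ht htm
    rw [smul_apply, hW', sub_apply, pairing_apply, S.map_vec, real_inner_comm, hs, S.form_vec,
      ht.2.1, hcoef t (Ioo_subset_Icc_self htm), smul_eq_mul]
  rw [e1, e2, integral_Ioo_eq_intervalIntegral hT.le, integral_Ioo_eq_intervalIntegral hT.le,
    ← intervalIntegral.integral_add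
      ((by fun_prop : Continuous fun t => deriv η t * y i t).intervalIntegrable 0 T)
      ((by fun_prop : Continuous fun t =>
        η t * (⟪S.basis i, f t⟫ - S.val i * y i t)).intervalIntegrable 0 T),
    intervalIntegral.integral_eq_sub_of_hasDerivAt
      (fun t _ => (hη.hasDerivAt t).mul (hyd i t))
      ((by fun_prop : Continuous fun t => deriv η t * y i t +
        η t * (⟪S.basis i, f t⟫ - S.val i * y i t)).intervalIntegrable 0 T)]
  simp [hη.eq_zero left_notMem_Ioo, hη.eq_zero right_notMem_Ioo]

end EigenSystem

end Existence

/-! ### Sobolev functions of one variable and compactness of the primitive. -/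

section Sobolev

theorem inner_eq_integral (f g : L2Ω) : ⟪f, g⟫ = ∫ x, f x * g x ∂μΩ := by
  rw [L2.inner_def]
  simp [mul_comm]

theorem norm_sq_eq_integral (f : L2Ω) : ‖f‖ ^ 2 = ∫ x, f x ^ 2 ∂μΩ := by
  rw [← real_inner_self_eq_norm_sq, inner_eq_integral]
  simp only [sq]

theorem integrableOn_coeFn (f : L2Ω) : IntegrableOn f (Ioo 0 1) :=
  (Lp.memLp f).integrable (by norm_num)

theorem intervalIntegrable_coeFn (f : L2Ω) : IntervalIntegrable f volume 0 1 :=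
  (intervalIntegrable_iff_integrableOn_Ioo_of_le zero_le_one).2 (integrableOn_coeFn f)

theorem continuousOn_primitive (f : L2Ω) :
    ContinuousOn (fun x => ∫ s in (0 : ℝ)..x, f s) (Icc 0 1) := by
  have := intervalIntegral.continuousOn_primitive_interval' (intervalIntegrable_coeFn f)
    left_mem_uIcc
  rwa [uIcc_of_le zero_le_one] at this

/-- Primitives of `L²` functions are Hölder continuous of exponent `1/2`; this gives both the sup
bounds and the equicontinuity below. -/
theorem sq_intervalIntegral_le (f : L2Ω) {x y : ℝ} (hx : 0 ≤ x) (hxy : x ≤ y) (hy : y ≤ 1) :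
    (∫ s in x..y, f s) ^ 2 ≤ (y - x) * ‖f‖ ^ 2 := by
  have hsub : Ioo x y ⊆ Ioo 0 1 := Ioo_subset_Ioo hx hy
  have hf : MemLp f 2 (volume.restrict (Ioo x y)) :=
    (Lp.memLp f).mono_measure (Measure.restrict_mono_set _ hsub)
  have h1 := sq_integral_mul_le (memLp_const (1 : ℝ)) hf
  have h2 : ∫ s in Ioo x y, f s ^ 2 ≤ ‖f‖ ^ 2 := by
    rw [norm_sq_eq_integral]
    exact setIntegral_mono_set (Lp.memLp f).integrable_sq
      (Eventually.of_forall fun _ => sq_nonneg _) hsub.eventuallyLE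
  rw [← integral_Ioo_eq_intervalIntegral hxy]
  simp only [one_mul, one_pow, integral_const, smul_eq_mul, mul_one] at h1
  rw [measureReal_restrict_apply_univ, Real.volume_real_Ioo_of_le hxy] at h1
  exact h1.trans (mul_le_mul_of_nonneg_left h2 (sub_nonneg.2 hxy))

theorem abs_primitive_le (f : L2Ω) {x : ℝ} (hx : x ∈ Icc (0 : ℝ) 1) :
    |∫ s in (0 : ℝ)..x, f s| ≤ ‖f‖ := by
  have h := sq_intervalIntegral_le f le_rfl hx.1 hx.2
  refine abs_le_of_sq_le_sq (h.trans ?_) (norm_nonneg f)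
  nlinarith [sq_nonneg ‖f‖, hx.2]

theorem HasWeakDeriv.exists_primitive {f g : L2Ω} (h : HasWeakDeriv f g) :
    ∃ c : ℝ, ∀ᵐ x ∂μΩ, f x = c + ∫ s in (0 : ℝ)..x, g s :=
  exists_ae_eq_primitive zero_lt_one (integrableOn_coeFn f) (integrableOn_coeFn g) h

theorem hasWeakDeriv_of_primitive {f g : L2Ω} {c : ℝ}
    (h : ∀ᵐ x ∂μΩ, f x = c + ∫ s in (0 : ℝ)..x, g s) : HasWeakDeriv f g := fun η hη => by
  rw [← integral_primitive_mul_deriv zero_le_one (integrableOn_coeFn g) c hη]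
  refine integral_congr_ae ?_
  filter_upwards [h] with x hx
  rw [hx]

/-- The continuous representative and `c + ∫₀ˣ g` agree a.e., hence on all of `[0, 1]`; the two end
points give `c = 0` and zero mean of `g`. -/
theorem HasWeakDeriv.primitive_of_zeroOnBoundary {f g : L2Ω} (h : HasWeakDeriv f g)
    (hf : ZeroOnBoundary f) :
    (∀ᵐ x ∂μΩ, f x = ∫ s in (0 : ℝ)..x, g s) ∧ ∫ s in (0 : ℝ)..1, g s = 0 := by
  obtain ⟨c, hc⟩ := h.exists_primitive
  obtain ⟨r, hr, h0, h1, hfr⟩ := hf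
  have hae : ∀ᵐ x ∂volume.restrict (Icc (0 : ℝ) 1), r x = c + ∫ s in (0 : ℝ)..x, g s := by
    rw [← Measure.restrict_congr_set Ioo_ae_eq_Icc]
    filter_upwards [hc, hfr] with x hx hx'
    rw [← hx, hx']
  have key := Measure.eqOn_Icc_of_ae_eq volume zero_ne_one hae hr
    (continuousOn_const.add (continuousOn_primitive g))
  have hc0 : c = 0 := by simpa [h0] using (key (left_mem_Icc.2 zero_le_one)).symm
  have hg : ∫ s in (0 : ℝ)..1, g s = 0 := by
    simpa [h1, hc0] using (key (right_mem_Icc.2 zero_le_one)).symm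
  refine ⟨?_, hg⟩
  filter_upwards [hc] with x hx
  rw [hx, hc0, zero_add]

theorem zeroOnBoundary_of_primitive {f g : L2Ω} (h : ∀ᵐ x ∂μΩ, f x = ∫ s in (0 : ℝ)..x, g s)
    (hg : ∫ s in (0 : ℝ)..1, g s = 0) : ZeroOnBoundary f :=
  ⟨_, continuousOn_primitive g, by simp, hg, h⟩

/-- Integration by parts in `H¹₀ × H¹`. -/
theorem HasWeakDeriv.inner_eq_neg {f f' g g' : L2Ω} (hf : HasWeakDeriv f f')
    (h0 : ZeroOnBoundary f) (hg : HasWeakDeriv g g') : ⟪f', g⟫ = -⟪f, g'⟫ := by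
  obtain ⟨h1, h2⟩ := hf.primitive_of_zeroOnBoundary h0
  obtain ⟨c, hc⟩ := hg.exists_primitive
  have h := integral_primitive_mul_add (intervalIntegrable_coeFn f')
    (intervalIntegrable_coeFn g') 0 c
  rw [h2] at h
  simp only [zero_add, zero_mul, sub_zero] at h
  rw [eq_neg_iff_add_eq_zero, ← h, inner_eq_integral, inner_eq_integral,
    ← integral_add (integrable_L2_mul f' (Lp.memLp g)) (integrable_L2_mul f (Lp.memLp g')),
    ← integral_Ioo_eq_intervalIntegral zero_le_one]
  refine integral_congr_ae ?_
  filter_upwards [h1, hc] with x hx hx'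
  rw [hx, hx']

theorem norm_le_of_ae_abs_le {f : L2Ω} {C : ℝ} (hC : 0 ≤ C) (h : ∀ᵐ x ∂μΩ, |f x| ≤ C) :
    ‖f‖ ≤ C := by
  have := Lp.norm_le_of_ae_bound (f := f) hC h
  simpa [measureUnivNNReal] using this

/-- The Poincaré inequality. -/
theorem HasWeakDeriv.norm_le {f f' : L2Ω} (hf : HasWeakDeriv f f') (h0 : ZeroOnBoundary f) :
    ‖f‖ ≤ ‖f'‖ := by
  refine norm_le_of_ae_abs_le (norm_nonneg _) ?_
  filter_upwards [(hf.primitive_of_zeroOnBoundary h0).1, ae_restrict_mem measurableSet_Ioo]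
    with x hx hxm
  rw [hx]
  exact abs_primitive_le f' (Ioo_subset_Icc_self hxm)

/-- The embedding of `H¹` into the bounded functions. -/
theorem HasWeakDeriv.ae_abs_le {f f' : L2Ω} (hf : HasWeakDeriv f f') :
    ∀ᵐ x ∂μΩ, |f x| ≤ ‖f‖ + 2 * ‖f'‖ := by
  obtain ⟨c, hc⟩ := hf.exists_primitive
  -- `f - c` is a primitive of `f'`, and since `Ω` has measure one the constant `c` has `L²` norm
  -- `|c|`.
  have hcc : |c| ≤ ‖f‖ + ‖f'‖ := by
    have hcm : MemLp (fun _ => c : ℝ → ℝ) 2 μΩ := memLp_const c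
    have h1 : ‖hcm.toLp‖ = |c| := by
      rw [Lp.norm_toLp, eLpNorm_const c (by norm_num) (by simp)]
      simp
    have h2 : ‖f - hcm.toLp‖ ≤ ‖f'‖ := by
      refine norm_le_of_ae_abs_le (norm_nonneg _) ?_
      filter_upwards [hc, Lp.coeFn_sub f hcm.toLp, hcm.coeFn_toLp,
        ae_restrict_mem measurableSet_Ioo] with x h3 h4 h5 hxm
      rw [h4, Pi.sub_apply, h5, h3, add_sub_cancel_left]
      exact abs_primitive_le f' (Ioo_subset_Icc_self hxm)
    rw [← h1]
    have := norm_sub_norm_le hcm.toLp f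
    rw [norm_sub_rev] at this
    linarith
  filter_upwards [hc, ae_restrict_mem measurableSet_Ioo] with x hx hxm
  rw [hx]
  have h1 := abs_add_le c (∫ s in (0 : ℝ)..x, f' s)
  have h2 := abs_primitive_le f' (Ioo_subset_Icc_self hxm)
  linarith

theorem eq_zero_of_integral_test {f : L2Ω} (h : ∀ φ, IsTest 0 1 φ → ∫ x, f x * φ x ∂μΩ = 0) :
    f = 0 := by
  refine Lp.ext ?_
  filter_upwards [ae_eq_zero_of_integral_test (integrableOn_coeFn f) h, Lp.coeFn_zero ℝ 2 μΩ]
    with x h1 h2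
  rw [h1, h2, Pi.zero_apply]

theorem HasWeakDeriv.eq_zero {g : L2Ω} (h : HasWeakDeriv 0 g) : g = 0 :=
  eq_zero_of_integral_test fun φ hφ => by
    have h1 := h φ hφ
    have h2 : ∫ x, (0 : L2Ω) x * deriv φ x ∂μΩ = 0 := by
      simpa using integral_L2_smul_mul 0 0 (deriv φ)
    rw [h2] at h1
    linarith

theorem inner_toLp (f : L2Ω) {φ : ℝ → ℝ} (h : MemLp φ 2 μΩ) :
    ⟪f, h.toLp⟫ = ∫ x, f x * φ x ∂μΩ := by
  rw [inner_eq_integral]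
  refine integral_congr_ae ?_
  filter_upwards [h.coeFn_toLp] with x hx
  rw [hx]

theorem isClosed_hasWeakDeriv : IsClosed {p : L2Ω × L2Ω | HasWeakDeriv p.1 p.2} := by
  have h : {p : L2Ω × L2Ω | HasWeakDeriv p.1 p.2} = ⋂ (φ : ℝ → ℝ) (hφ : IsTest 0 1 φ),
      {p | ⟪p.1, (hφ.memLp_deriv.toLp : L2Ω)⟫ = -⟪p.2, (hφ.memLp.toLp : L2Ω)⟫} := by
    ext p
    simp only [mem_iInter, mem_ofPred_eq, HasWeakDeriv, inner_toLp]
  rw [h]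
  exact isClosed_iInter fun φ => isClosed_iInter fun hφ =>
    isClosed_eq (by fun_prop) (by fun_prop)

/-- The primitive `x ↦ ∫₀ˣ g` as a continuous function. -/
def primitiveₗ : L2Ω →ₗ[ℝ] (BoundedContinuousFunction (Icc (0 : ℝ) 1) ℝ) where
  toFun g := BoundedContinuousFunction.mkOfCompact
    ⟨fun x => ∫ s in (0 : ℝ)..x, g s, (continuousOn_primitive g).domRestrict⟩
  map_add' f g := by
    ext x
    have hI : ∀ f : L2Ω, IntervalIntegrable f volume 0 x := fun f =>
      (intervalIntegrable_coeFn f).mono_set (by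
        rw [uIcc_of_le x.2.1, uIcc_of_le zero_le_one]; exact Icc_subset_Icc_right x.2.2)
    change ∫ s in (0 : ℝ)..x, (f + g : L2Ω) s = (∫ s in (0 : ℝ)..x, f s) + ∫ s in (0 : ℝ)..x, g s
    rw [← intervalIntegral.integral_add (hI f) (hI g), ← integral_Ioo_eq_intervalIntegral x.2.1,
      ← integral_Ioo_eq_intervalIntegral x.2.1]
    exact integral_congr_ae (ae_restrict_of_ae_restrict_of_subset (Ioo_subset_Ioo_right x.2.2)
      (Lp.coeFn_add f g))
  map_smul' c g := by
    ext x
    change ∫ s in (0 : ℝ)..x, (c • g : L2Ω) s = c * ∫ s in (0 : ℝ)..x, g s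
    rw [← intervalIntegral.integral_const_mul, ← integral_Ioo_eq_intervalIntegral x.2.1,
      ← integral_Ioo_eq_intervalIntegral x.2.1]
    exact integral_congr_ae (ae_restrict_of_ae_restrict_of_subset (Ioo_subset_Ioo_right x.2.2)
      (Lp.coeFn_smul c g))

/-- The primitive `x ↦ ∫₀ˣ g` as a bounded operator. -/
def primitive : L2Ω →L[ℝ] (BoundedContinuousFunction (Icc (0 : ℝ) 1) ℝ) :=
  primitiveₗ.mkContinuous 1 fun g => by
    rw [one_mul, BoundedContinuousFunction.norm_le (norm_nonneg g)]
    exact fun x => abs_primitive_le g x.2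

theorem primitive_apply (g : L2Ω) (x : Icc (0 : ℝ) 1) :
    primitive g x = ∫ s in (0 : ℝ)..x, g s := rfl

theorem memLp_IccExtend (h : BoundedContinuousFunction (Icc (0 : ℝ) 1) ℝ) :
    MemLp (IccExtend zero_le_one h) 2 μΩ :=
  memLp_of_continuousOn h.continuous.Icc_extend'.continuousOn

/-- The embedding of the continuous functions on `[0,1]` into `L²(Ω)`. -/
def boundedToL2 : (BoundedContinuousFunction (Icc (0 : ℝ) 1) ℝ) →L[ℝ] L2Ω :=
  LinearMap.mkContinuous
    { toFun := fun h => (memLp_IccExtend h).toLp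
      map_add' := fun _ _ => rfl
      map_smul' := fun _ _ => rfl } 1 fun h => by
    rw [one_mul]
    refine norm_le_of_ae_abs_le (norm_nonneg h) ?_
    filter_upwards [(memLp_IccExtend h).coeFn_toLp] with x hx
    change |((memLp_IccExtend h).toLp : L2Ω) x| ≤ _
    rw [hx]
    exact h.norm_coe_le_norm _

theorem boundedToL2_primitive (g : L2Ω) :
    ∀ᵐ x ∂μΩ, boundedToL2 (primitive g) x = ∫ s in (0 : ℝ)..x, g s := by
  filter_upwards [(memLp_IccExtend (primitive g)).coeFn_toLp, ae_restrict_mem measurableSet_Ioo]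
    with x hx hxm
  refine hx.trans ?_
  rw [IccExtend_of_mem _ _ (Ioo_subset_Icc_self hxm), primitive_apply]

/-- Arzelà–Ascoli: primitives of the unit ball are bounded by one and share the modulus of
continuity `√|x - y|`. -/
theorem isCompactOperator_primitive : IsCompactOperator primitive := by
  refine (isCompactOperator_iff_exists_mem_nhds_isCompact_closure_image _).2
    ⟨Metric.closedBall 0 1, Metric.closedBall_mem_nhds _ zero_lt_one, ?_⟩
  refine BoundedContinuousFunction.arzela_ascoli (Icc (-1 : ℝ) 1) isCompact_Icc _ ?_ ?_
  · rintro _ x ⟨g, hg, rfl⟩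
    rw [mem_closedBall_zero_iff] at hg
    exact abs_le.1 ((abs_primitive_le g x.2).trans hg)
  · refine UniformEquicontinuous.equicontinuous ?_
    rw [Metric.uniformEquicontinuous_iff]
    intro ε hε
    refine ⟨ε ^ 2, by positivity, ?_⟩
    rintro x y hxy ⟨_, g, hg, rfl⟩
    rw [mem_closedBall_zero_iff] at hg
    have key : ∀ x y : Icc (0 : ℝ) 1, x ≤ y → dist x y < ε ^ 2 →
        dist (primitive g x) (primitive g y) < ε := by
      intro x y hle hxy
      rw [Subtype.dist_eq, dist_comm, Real.dist_eq,
        abs_of_nonneg (sub_nonneg.2 (Subtype.coe_le_coe.2 hle))] at hxy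
      have hI : ∀ z : Icc (0 : ℝ) 1, IntervalIntegrable g volume 0 z := fun z =>
        (intervalIntegrable_coeFn g).mono_set (by
          rw [uIcc_of_le z.2.1, uIcc_of_le zero_le_one]; exact Icc_subset_Icc_right z.2.2)
      have h1 := sq_intervalIntegral_le g x.2.1 hle y.2.2
      rw [dist_comm, Real.dist_eq, primitive_apply, primitive_apply,
        intervalIntegral.integral_interval_sub_left (hI y) (hI x)]
      refine abs_lt_of_sq_lt_sq (h1.trans_lt ?_) hε.le
      have h2 : ‖g‖ ^ 2 ≤ 1 := pow_le_one₀ (norm_nonneg g) hg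
      have h3 : (0 : ℝ) ≤ y - x := sub_nonneg.2 hle
      nlinarith
    rcases le_total x y with h | h
    · exact key x y h hxy
    · rw [dist_comm]
      exact key y x h (by rwa [dist_comm])

end Sobolev

/-! ### The spaces `H¹₀` and `V²₀` and their forms. -/

section Spaces

variable {n : ℕ}

theorem wderiv_apply {m : ℕ} {S : Submodule ℝ (Jet m)} (i : Fin (m + 1)) (z : S) :
    (wderiv i z : L2Ω) = (z : Jet m) i := rfl

theorem norm_sq_eq_sum {m : ℕ} {S : Submodule ℝ (Jet m)} (z : S) :
    ‖z‖ ^ 2 = ∑ i, ‖(wderiv i z : L2Ω)‖ ^ 2 :=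
  PiLp.norm_sq_eq_of_L2 _ _

theorem norm_wderiv_le {m : ℕ} {S : Submodule ℝ (Jet m)} (i : Fin (m + 1)) (z : S) :
    ‖(wderiv i z : L2Ω)‖ ≤ ‖z‖ := by
  refine le_of_sq_le_sq ?_ (norm_nonneg z)
  rw [norm_sq_eq_sum]
  exact Finset.single_le_sum (f := fun i => ‖(wderiv i z : L2Ω)‖ ^ 2) (fun _ _ => sq_nonneg _)
    (Finset.mem_univ i)

theorem hasWeakDeriv_wderiv (z : sobolev (n + 1)) : HasWeakDeriv (wderiv 0 z) (wderiv 1 z) :=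
  z.2 0

theorem sobolevZero_hasWeakDeriv (z : sobolevZero (n + 1)) :
    HasWeakDeriv (wderiv 0 z) (wderiv 1 z) :=
  z.2.1 0

theorem zeroOnBoundary_wderiv {m : ℕ} (z : sobolevZero m) : ZeroOnBoundary (wderiv 0 z) := z.2.2

/-- Replaces the existential boundary condition by equations between continuous functions of the
jet, which yields closedness and the factorisation of the embedding through `primitive`. -/
theorem mem_sobolevZero_iff {z : Jet (n + 1)} : z ∈ sobolevZero (n + 1) ↔
    (∀ i : Fin (n + 1), HasWeakDeriv (z i.castSucc) (z i.succ)) ∧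
      z 0 = boundedToL2 (primitive (z 1)) ∧
      primitive (z 1) ⟨1, right_mem_Icc.2 zero_le_one⟩ = 0 := by
  constructor
  · rintro ⟨h1, h2⟩
    obtain ⟨h3, h4⟩ := HasWeakDeriv.primitive_of_zeroOnBoundary (h1 0) h2
    refine ⟨h1, Lp.ext ?_, h4⟩
    filter_upwards [h3, boundedToL2_primitive (z 1)] with x hx hx'
    rw [hx']
    exact hx
  · rintro ⟨h1, h2, h3⟩
    refine ⟨h1, zeroOnBoundary_of_primitive (g := z 1) ?_ h3⟩
    change ∀ᵐ x ∂μΩ, (z 0 : L2Ω) x = _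
    rw [h2]
    exact boundedToL2_primitive (z 1)

theorem isClosed_sobolevZero : IsClosed (sobolevZero (n + 1) : Set (Jet (n + 1))) := by
  have h : (sobolevZero (n + 1) : Set (Jet (n + 1))) =
      (⋂ i : Fin (n + 1), {z | HasWeakDeriv (z i.castSucc) (z i.succ)}) ∩
      ({z | z 0 = boundedToL2 (primitive (z 1))} ∩
        {z | primitive (z 1) ⟨1, right_mem_Icc.2 zero_le_one⟩ = 0}) := by
    ext z
    simp only [SetLike.mem_coe, mem_sobolevZero_iff, mem_inter_iff, mem_iInter, mem_ofPred_eq]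
  rw [h]
  have hp : ∀ i, Continuous fun z : Jet (n + 1) => z i := fun i => by fun_prop
  refine (isClosed_iInter fun i => ?_).inter (IsClosed.inter ?_ ?_)
  · exact isClosed_hasWeakDeriv.preimage ((hp i.castSucc).prodMk (hp i.succ))
  · exact isClosed_eq (hp 0) (by fun_prop)
  · refine isClosed_eq ?_ continuous_const
    exact (BoundedContinuousFunction.evalCLM ℝ (⟨1, right_mem_Icc.2 zero_le_one⟩ :
      Icc (0 : ℝ) 1)).continuous.comp (primitive.continuous.comp (hp 1))

instance : CompleteSpace (sobolevZero (n + 1)) := isClosed_sobolevZero.completeSpace_coe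

theorem isCompactOperator_wderiv_zero :
    IsCompactOperator (wderiv 0 : sobolevZero (n + 1) →L[ℝ] L2Ω) := by
  have h : (wderiv 0 : sobolevZero (n + 1) →L[ℝ] L2Ω) =
      (boundedToL2.comp primitive).comp (wderiv 1) := by
    ext1 z
    exact (mem_sobolevZero_iff.1 z.2).2.1
  rw [h]
  exact (isCompactOperator_primitive.clm_comp boundedToL2).comp_clm (wderiv 1)

/-- Weak derivatives are unique, so a jet is determined by its zeroth component. -/
theorem wderiv_zero_injective {m : ℕ} :
    Function.Injective (wderiv 0 : sobolevZero m →L[ℝ] L2Ω) := by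
  rw [injective_iff_map_eq_zero]
  intro z hz
  have h : ∀ i : Fin (m + 1), (z : Jet m) i = 0 := fun i => by
    induction i using Fin.induction with
    | zero => exact hz
    | succ i ih =>
      have := z.2.1 i
      rw [ih] at this
      exact this.eq_zero
  ext1
  ext1 i
  exact h i

theorem hasWeakDeriv_toLp {φ φ' : ℝ → ℝ} (hd : ∀ x, HasDerivAt φ (φ' x) x) (hc : Continuous φ')
    (h : MemLp φ 2 μΩ) (h' : MemLp φ' 2 μΩ) : HasWeakDeriv h.toLp h'.toLp := by
  refine hasWeakDeriv_of_primitive (c := φ 0) ?_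
  filter_upwards [h.coeFn_toLp, ae_restrict_mem measurableSet_Ioo] with x hx hxm
  have h1 : ∫ s in (0 : ℝ)..x, (h'.toLp : L2Ω) s = ∫ s in (0 : ℝ)..x, φ' s := by
    rw [← integral_Ioo_eq_intervalIntegral hxm.1.le, ← integral_Ioo_eq_intervalIntegral hxm.1.le]
    exact integral_congr_ae (ae_restrict_of_ae_restrict_of_subset
      (Ioo_subset_Ioo_right hxm.2.le) h'.coeFn_toLp)
  rw [hx, h1, intervalIntegral.integral_eq_sub_of_hasDerivAt (fun s _ => hd s)
    (hc.intervalIntegrable _ _)]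
  ring

theorem IsTest.iteratedDeriv {a b : ℝ} {φ : ℝ → ℝ} (h : IsTest a b φ) (k : ℕ) :
    IsTest a b (iteratedDeriv k φ) := by
  induction k with
  | zero => simpa using h
  | succ k ih => simpa only [iteratedDeriv_succ] using ih.deriv

theorem IsTest.exists_sobolevZero {φ : ℝ → ℝ} (h : IsTest 0 1 φ) (m : ℕ) :
    ∃ z : sobolevZero m, (wderiv 0 z : L2Ω) = h.memLp.toLp := by
  refine ⟨⟨WithLp.toLp 2 fun i => ((h.iteratedDeriv i).memLp.toLp : L2Ω), fun i => ?_, ?_⟩, ?_⟩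
  · refine hasWeakDeriv_toLp (fun x => ?_) (h.iteratedDeriv _).continuous
      (h.iteratedDeriv i.castSucc).memLp (h.iteratedDeriv i.succ).memLp
    have := (h.iteratedDeriv i).hasDerivAt x
    rwa [← iteratedDeriv_succ] at this
  · refine ⟨φ, h.continuous.continuousOn, h.eq_zero left_notMem_Ioo, h.eq_zero right_notMem_Ioo, ?_⟩
    filter_upwards [(h.iteratedDeriv 0).memLp.coeFn_toLp] with x hx
    refine hx.trans ?_
    simp
  · rw [wderiv_apply]
    simp

theorem eq_zero_of_inner_wderiv_zero {m : ℕ} {f : L2Ω}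
    (h : ∀ z : sobolevZero m, ⟪f, (wderiv 0 z : L2Ω)⟫ = 0) : f = 0 :=
  eq_zero_of_integral_test fun φ hφ => by
    obtain ⟨z, hz⟩ := hφ.exists_sobolevZero m
    rw [← inner_toLp f hφ.memLp, ← hz, h]

theorem H10.norm_sq_le (z : H10) : ‖z‖ ^ 2 ≤ 2 * ‖(wderiv 1 z : L2Ω)‖ ^ 2 := by
  rw [norm_sq_eq_sum, Fin.sum_univ_two]
  have h := pow_le_pow_left₀ (norm_nonneg _)
    ((sobolevZero_hasWeakDeriv z).norm_le (zeroOnBoundary_wderiv z)) 2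
  linarith

/-- Integration by parts gives `‖z_x‖² = -(z, z_xx)`, and with Poincaré's inequality `‖z‖ ≤ ‖z_x‖ ≤
‖z_xx‖`. -/
theorem V02.norm_sq_le (z : V02) : ‖z‖ ^ 2 ≤ 3 * ‖(wderiv 2 z : L2Ω)‖ ^ 2 := by
  rw [norm_sq_eq_sum, Fin.sum_univ_three]
  have h1 := (sobolevZero_hasWeakDeriv z).norm_le (zeroOnBoundary_wderiv z)
  have h2 : HasWeakDeriv (wderiv 1 z) (wderiv 2 z) := z.2.1 1
  have h3 := (sobolevZero_hasWeakDeriv z).inner_eq_neg (zeroOnBoundary_wderiv z) h2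
  rw [real_inner_self_eq_norm_sq] at h3
  have h4 := abs_real_inner_le_norm (wderiv 0 z : L2Ω) (wderiv 2 z)
  have h5 := neg_abs_le ⟪(wderiv 0 z : L2Ω), (wderiv 2 z : L2Ω)⟫
  set A := ‖(wderiv 0 z : L2Ω)‖
  set B := ‖(wderiv 1 z : L2Ω)‖
  set C := ‖(wderiv 2 z : L2Ω)‖
  have hA : 0 ≤ A := norm_nonneg _
  have hB : 0 ≤ B := norm_nonneg _
  have hC : 0 ≤ C := norm_nonneg _
  have h6 : B ^ 2 ≤ B * C := by nlinarith
  have h7 : B ^ 2 ≤ C ^ 2 := by nlinarith [sq_nonneg (B - C)]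
  have h8 : A ^ 2 ≤ B ^ 2 := pow_le_pow_left₀ hA h1 2
  linarith

/-- The form `(u_xx, φ_xx)` on `V²₀`. -/
def biharmonicForm : V02 →L[ℝ] V02 →L[ℝ] ℝ :=
  (innerSL ℝ : L2Ω →L[ℝ] _).bilinearComp (wderiv 2) (wderiv 2)

theorem biharmonicForm_apply (u φ : V02) :
    biharmonicForm u φ = ⟪(wderiv 2 u : L2Ω), (wderiv 2 φ : L2Ω)⟫ := rfl

theorem biharmonicForm_symm (u φ : V02) : biharmonicForm u φ = biharmonicForm φ u := by
  rw [biharmonicForm_apply, biharmonicForm_apply, real_inner_comm]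

theorem biharmonicForm_coercive (u : V02) : (1 / 3 : ℝ) * ‖u‖ ^ 2 ≤ biharmonicForm u u := by
  rw [biharmonicForm_apply, real_inner_self_eq_norm_sq]
  linarith [u.norm_sq_le]

/-- The one-dimensional embedding `H¹ ⊂ L^∞` makes multiplication by `d` bounded on `L²` and turns
convergence of coefficients in `H¹` into uniform convergence. -/
theorem H1.ae_abs_le (d : H1) : ∀ᵐ x ∂μΩ, |(wderiv 0 d : L2Ω) x| ≤ 3 * ‖d‖ := by
  filter_upwards [(hasWeakDeriv_wderiv d).ae_abs_le] with x hx
  linarith [norm_wderiv_le 0 d, norm_wderiv_le 1 d]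

theorem memLp_mul (d : H1) (f : L2Ω) : MemLp (fun x => (wderiv 0 d : L2Ω) x * f x) 2 μΩ := by
  refine (Lp.memLp f).of_le_mul (c := 3 * ‖d‖)
    ((Lp.aestronglyMeasurable _).mul (Lp.aestronglyMeasurable _)) ?_
  filter_upwards [d.ae_abs_le] with x hx
  rw [norm_mul]
  gcongr
  exact hx

/-- Multiplication by `d ∈ H¹(Ω)` as an operator on `L²(Ω)`. -/
def mulOp (d : H1) : L2Ω →L[ℝ] L2Ω :=
  LinearMap.mkContinuous
    { toFun := fun f => (memLp_mul d f).toLp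
      map_add' := fun f g => by
        refine Lp.ext ?_
        filter_upwards [(memLp_mul d f).coeFn_toLp, (memLp_mul d g).coeFn_toLp,
          (memLp_mul d (f + g)).coeFn_toLp, Lp.coeFn_add f g,
          Lp.coeFn_add (memLp_mul d f).toLp (memLp_mul d g).toLp] with x h1 h2 h3 h4 h5
        rw [h3, h5, Pi.add_apply, h1, h2, h4, Pi.add_apply, mul_add]
      map_smul' := fun c f => by
        refine Lp.ext ?_
        filter_upwards [(memLp_mul d f).coeFn_toLp, (memLp_mul d (c • f)).coeFn_toLp,
          Lp.coeFn_smul c f, Lp.coeFn_smul c (memLp_mul d f).toLp] with x h1 h2 h3 h4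
        rw [RingHom.id_apply, h2, h4, Pi.smul_apply, h1, h3, Pi.smul_apply, smul_eq_mul,
          smul_eq_mul, mul_left_comm] } (3 * ‖d‖) fun f => by
    refine Lp.norm_le_mul_norm_of_ae_le_mul ?_
    filter_upwards [(memLp_mul d f).coeFn_toLp, d.ae_abs_le] with x h1 h2
    change ‖((memLp_mul d f).toLp : L2Ω) x‖ ≤ _
    rw [h1, norm_mul]
    gcongr
    exact h2

theorem coeFn_mulOp (d : H1) (f : L2Ω) :
    ∀ᵐ x ∂μΩ, mulOp d f x = (wderiv 0 d : L2Ω) x * f x :=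
  (memLp_mul d f).coeFn_toLp

/-- Any a.e. bound `C` is allowed, since the instability argument needs dependence on the supremum
norm alone. -/
theorem norm_mulOp_le {d : H1} {C : ℝ} (h : ∀ᵐ x ∂μΩ, |(wderiv 0 d : L2Ω) x| ≤ C) (f : L2Ω) :
    ‖mulOp d f‖ ≤ C * ‖f‖ := by
  refine Lp.norm_le_mul_norm_of_ae_le_mul ?_
  filter_upwards [coeFn_mulOp d f, h] with x h1 h2
  rw [h1, norm_mul]
  gcongr
  exact h2

theorem mulOp_sub (d d' : H1) (f : L2Ω) : mulOp (d - d') f = mulOp d f - mulOp d' f := by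
  refine Lp.ext ?_
  filter_upwards [coeFn_mulOp d f, coeFn_mulOp d' f, coeFn_mulOp (d - d') f,
    Lp.coeFn_sub (mulOp d f) (mulOp d' f),
    Lp.coeFn_sub (wderiv 0 d : L2Ω) (wderiv 0 d')] with x h1 h2 h3 h4 h5
  rw [h3, h4, Pi.sub_apply, h1, h2, map_sub, h5, Pi.sub_apply, sub_mul]

theorem inner_mulOp (d : H1) (f g : L2Ω) :
    ⟪mulOp d f, g⟫ = ∫ x, (wderiv 0 d : L2Ω) x * f x * g x ∂μΩ := by
  rw [inner_eq_integral]
  refine integral_congr_ae ?_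
  filter_upwards [coeFn_mulOp d f] with x hx
  rw [hx]

theorem inner_mulOp_self_ge {d : H1} {α : ℝ} (h : ∀ᵐ x ∂μΩ, α ≤ (wderiv 0 d : L2Ω) x) (f : L2Ω) :
    α * ‖f‖ ^ 2 ≤ ⟪mulOp d f, f⟫ := by
  rw [inner_eq_integral, norm_sq_eq_integral, ← integral_const_mul]
  refine integral_mono_ae ((Lp.memLp f).integrable_sq.const_mul α)
    (integrable_L2_mul _ (Lp.memLp f)) ?_
  filter_upwards [coeFn_mulOp d f, h] with x h1 h2
  change α * f x ^ 2 ≤ _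
  rw [h1]
  nlinarith [sq_nonneg (f x)]

/-- The form `(d u_x, φ_x)` on `H¹₀`. -/
def diffusionForm (d : H1) : H10 →L[ℝ] H10 →L[ℝ] ℝ :=
  (innerSL ℝ : L2Ω →L[ℝ] _).bilinearComp ((mulOp d).comp (wderiv 1)) (wderiv 1)

theorem diffusionForm_apply (d : H1) (u φ : H10) :
    diffusionForm d u φ = ⟪mulOp d (wderiv 1 u), (wderiv 1 φ : L2Ω)⟫ := rfl

theorem diffusionForm_symm (d : H1) (u φ : H10) : diffusionForm d u φ = diffusionForm d φ u := by
  rw [diffusionForm_apply, diffusionForm_apply, inner_mulOp, inner_mulOp]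
  refine integral_congr_ae (Eventually.of_forall fun x => ?_)
  change _ * _ * _ = _ * _ * _
  ring

theorem diffusionForm_coercive {d : H1} {α : ℝ} (hα : 0 < α)
    (h : ∀ᵐ x ∂μΩ, α ≤ (wderiv 0 d : L2Ω) x) (u : H10) :
    α / 2 * ‖u‖ ^ 2 ≤ diffusionForm d u u := by
  rw [diffusionForm_apply]
  have h1 := inner_mulOp_self_ge h (wderiv 1 u)
  have h2 := u.norm_sq_le
  nlinarith

/-- `V²₀` is dense in `H¹₀`. -/
theorem eq_zero_of_forall_toH10 {F : StrongDual ℝ H10} (h : ∀ φ : V02, F φ.toH10 = 0) : F = 0 := by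
  set a : H10 →L[ℝ] H10 →L[ℝ] ℝ := (innerSL ℝ : L2Ω →L[ℝ] _).bilinearComp (wderiv 1) (wderiv 1)
    with ha
  have ha' : ∀ u φ, a u φ = ⟪(wderiv 1 u : L2Ω), (wderiv 1 φ : L2Ω)⟫ := fun _ _ => rfl
  have hc : IsCoercive a := ⟨1 / 2, by norm_num, fun u => by
    rw [ha', real_inner_self_eq_norm_sq]
    nlinarith [u.norm_sq_le]⟩
  obtain ⟨G, hG⟩ := hc.exists_solutionOperator (ContinuousLinearMap.id ℝ H10)
  obtain ⟨P, hP⟩ := hc.exists_solutionOperator (wderiv 0 : H10 →L[ℝ] L2Ω)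
  set g := G ((InnerProductSpace.toDual ℝ H10).symm F) with hg
  have hF : ∀ φ, a g φ = F φ := fun φ => by rw [hg, hG]; simp
  -- `φ` solves `-φ'' = g`, so it comes from `V²₀`; as `F = a(g, ·)`, evaluating `F` there gives
  -- `‖g‖²` in `L²`, which forces `g = 0`.
  set φ := P (wderiv 0 g) with hφ
  have hφ2 : HasWeakDeriv (wderiv 1 φ) (-(wderiv 0 g)) := fun η hη => by
    obtain ⟨z, hz⟩ := hη.exists_sobolevZero 1
    have h1 := hP (wderiv 0 g) z
    rw [← hφ, ha'] at h1
    have h2 : (wderiv 1 z : L2Ω) = hη.memLp_deriv.toLp := by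
      have h3 := hasWeakDeriv_toLp hη.hasDerivAt hη.continuous_deriv hη.memLp hη.memLp_deriv
      have h4 := (sobolevZero_hasWeakDeriv z).add (h3.smul (-1))
      rw [hz] at h4
      simp only [neg_smul, one_smul, add_neg_cancel] at h4
      exact add_neg_eq_zero.1 h4.eq_zero
    rw [h2, hz, inner_toLp, inner_toLp] at h1
    rw [h1, ← integral_neg]
    refine integral_congr_ae ?_
    filter_upwards [Lp.coeFn_neg (wderiv 0 g : L2Ω)] with x hx
    rw [hx, Pi.neg_apply]
    ring
  let Φ : V02 := ⟨WithLp.toLp 2 ![wderiv 0 φ, wderiv 1 φ, -(wderiv 0 g)], by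
    refine ⟨fun i => ?_, zeroOnBoundary_wderiv φ⟩
    fin_cases i
    · exact sobolevZero_hasWeakDeriv φ
    · exact hφ2⟩
  have h0 : F Φ.toH10 = 0 := h Φ
  have hΦ : Φ.toH10 = φ := wderiv_zero_injective rfl
  rw [hΦ, ← hF, ha', real_inner_comm, ← ha', hφ, hP, inner_self_eq_zero] at h0
  have hg0 : g = 0 := wderiv_zero_injective (h0.trans (map_zero _).symm)
  ext ψ
  rw [← hF, hg0]
  simp

end Spaces

/-! ### The cascade system: well-posedness, stability and smoothing. -/

section Cascade

variable {T : ℝ}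

/-- Without source, each coefficient is only multiplied by `exp(-λ_i t) ≤ 1`. -/
theorem EigenSystem.norm_le_initial {V H : Type*} [NormedAddCommGroup V] [InnerProductSpace ℝ V]
    [NormedAddCommGroup H] [InnerProductSpace ℝ H] {j : V →L[ℝ] H} {a : V →L[ℝ] V →L[ℝ] ℝ}
    {ι : Type*} (S : EigenSystem j a ι) (hT : 0 < T) (hs : ∀ v w, a v w = a w v) {w : ℝ → H}
    {W : ℝ → V} {W' : ℝ → StrongDual ℝ V} (h : IsSolution T j a (fun _ => pairing j 0) w W W')
    {t : ℝ} (ht : t ∈ Icc 0 T) : ‖w t‖ ≤ ‖w 0‖ := by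
  refine le_of_sq_le_sq ?_ (norm_nonneg _)
  refine S.norm_sq_le fun s => le_trans (Finset.sum_le_sum fun i _ => ?_) (S.sum_sq_le (w 0) s)
  have h1 := S.duhamel hT hs h i ht
  simp only [pairing_apply, inner_zero_left, mul_zero, intervalIntegral.integral_zero,
    add_zero] at h1
  rw [h1, mul_pow]
  refine mul_le_of_le_one_left (sq_nonneg _) (pow_le_one₀ (Real.exp_pos _).le ?_)
  rw [Real.exp_le_one_iff]
  nlinarith [S.val_pos i, ht.1]

theorem norm_pairing_wderiv_le {m : ℕ} {S : Submodule ℝ (Jet m)} (h : L2Ω) :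
    ‖pairing (wderiv 0 : S →L[ℝ] L2Ω) h‖ ≤ ‖h‖ := by
  refine ContinuousLinearMap.opNorm_le_bound _ (norm_nonneg h) fun φ => ?_
  rw [pairing_apply]
  exact (abs_real_inner_le_norm _ _).trans
    (mul_le_mul_of_nonneg_left (norm_wderiv_le 0 φ) (norm_nonneg h))

/-- Separates the system into two abstract problems. The definition tests the `v`-equation only with
`V²₀`; density extends it to `H¹₀`. The zero source is written as a pairing to match
`exists_lift_final`. -/
theorem isWeakSolution_iff {d : H1} {u₀ v₀ : L2Ω} {u v : ℝ → L2Ω} :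
    IsWeakSolution T d u₀ v₀ u v ↔ u 0 = u₀ ∧ v 0 = v₀ ∧ ∃ U U' V V',
      IsSolution T (wderiv 0 : V02 →L[ℝ] L2Ω) biharmonicForm
        (fun t => pairing (wderiv 0) (v t)) u U U' ∧
      IsSolution T (wderiv 0 : H10 →L[ℝ] L2Ω) (diffusionForm d)
        (fun _ => pairing (wderiv 0) 0) v V V' := by
  constructor
  · rintro ⟨hu, hv, hu0, hv0, U, V, U', V', hae, hU, hV, hU', hV', hdU, hdV, heq⟩
    refine ⟨hu0, hv0, U, U', V, V', ⟨hu, hae.mono fun t ht => ht.1, hU, hU', hdU, ?_⟩,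
      ⟨hv, hae.mono fun t ht => ht.2, hV, hV', hdV, ?_⟩⟩
    · filter_upwards [hae, heq] with t ht h
      ext φ
      rw [add_apply, biharmonicForm_apply, (h φ).1, pairing_apply, ht.2]
    · filter_upwards [heq] with t h
      rw [← sub_eq_zero]
      refine eq_zero_of_forall_toH10 fun φ => ?_
      have h1 := (h φ).2
      rw [sub_apply, add_apply, diffusionForm_apply, pairing_apply, inner_zero_left, sub_zero,
        inner_mulOp]
      exact h1
  · rintro ⟨hu0, hv0, U, U', V, V', h1, h2⟩
    refine ⟨h1.continuousOn, h2.continuousOn, hu0, hv0, U, V, U', V', h1.ae_eq.and h2.ae_eq,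
      h1.inL2, h2.inL2, h1.inL2', h2.inL2', h1.weak, h2.weak, ?_⟩
    filter_upwards [h1.eq, h2.eq, h2.ae_eq] with t e1 e2 e3 φ
    constructor
    · have := congrArg (fun L : StrongDual ℝ V02 => L φ) e1
      rw [e3]
      exact this
    · have := congrArg (fun L : StrongDual ℝ H10 => L φ.toH10) e2
      simp only [add_apply, diffusionForm_apply, pairing_apply, inner_zero_left,
        inner_mulOp] at this
      exact this

instance : TopologicalSpace.SeparableSpace L2Ω :=
  haveI : Fact ((2 : ENNReal) ≠ ⊤) := ⟨by simp⟩
  inferInstance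

theorem exists_eigenSystem_biharmonic :
    ∃ ι : Type, Countable ι ∧
      Nonempty (EigenSystem (wderiv 0 : V02 →L[ℝ] L2Ω) biharmonicForm ι) :=
  exists_eigenSystem isCompactOperator_wderiv_zero (fun _ h => eq_zero_of_inner_wderiv_zero h)
    biharmonicForm_symm ⟨1 / 3, by norm_num, fun u => by
      have := biharmonicForm_coercive u
      rwa [sq, ← mul_assoc] at this⟩

theorem exists_eigenSystem_diffusion {d : H1} {α : ℝ} (hα : 0 < α)
    (hd : ∀ᵐ x ∂μΩ, α ≤ (wderiv 0 d : L2Ω) x) :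
    ∃ ι : Type, Countable ι ∧
      Nonempty (EigenSystem (wderiv 0 : H10 →L[ℝ] L2Ω) (diffusionForm d) ι) :=
  exists_eigenSystem isCompactOperator_wderiv_zero (fun _ h => eq_zero_of_inner_wderiv_zero h)
    (diffusionForm_symm d) ⟨α / 2, by positivity, fun u => by
      have := diffusionForm_coercive hα hd u
      rwa [sq, ← mul_assoc] at this⟩

/-- The `v`-equation does not involve `u`, so it is solved first and its continuous solution is the
source for `u`. -/
theorem exists_isWeakSolution (hT : 0 < T) {d : H1} {α : ℝ} (hα : 0 < α)
    (hd : ∀ᵐ x ∂μΩ, α ≤ (wderiv 0 d : L2Ω) x) (u₀ v₀ : L2Ω) :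
    ∃ u v, IsWeakSolution T d u₀ v₀ u v := by
  obtain ⟨ι, _, ⟨S⟩⟩ := exists_eigenSystem_diffusion hα hd
  obtain ⟨κ, _, ⟨R⟩⟩ := exists_eigenSystem_biharmonic
  obtain ⟨v, V, V', hvc, hv0, hv⟩ := S.exists_isSolution hT (diffusionForm_symm d)
    (by positivity) (diffusionForm_coercive hα hd) wderiv_zero_injective v₀
    (f := fun _ => 0) continuous_const
  obtain ⟨u, U, U', -, hu0, hu⟩ := R.exists_isSolution hT biharmonicForm_symm
    (by norm_num) biharmonicForm_coercive wderiv_zero_injective u₀ hvc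
  exact ⟨u, v, isWeakSolution_iff.2 ⟨hu0, hv0, U, U', V, V', hu, hv⟩⟩

/-- Lipschitz dependence of the solution on the coefficient, with respect to the supremum norm. -/
theorem IsWeakSolution.exists_lipschitz (hT : 0 < T) {d : H1} {u₀ v₀ : L2Ω} {u v : ℝ → L2Ω}
    (h : IsWeakSolution T d u₀ v₀ u v) {α : ℝ} (hα : 0 < α) :
    ∃ K, 0 ≤ K ∧ ∀ (d' : H1) (u' v' : ℝ → L2Ω) (δ : ℝ),
      (∀ᵐ x ∂μΩ, α ≤ (wderiv 0 d' : L2Ω) x) → IsWeakSolution T d' u₀ v₀ u' v' → 0 ≤ δ →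
      (∀ᵐ x ∂μΩ, |(wderiv 0 (d' - d) : L2Ω) x| ≤ δ) →
      ∀ t ∈ Icc 0 T, ‖u' t - u t‖ ≤ K * δ ∧ ‖v' t - v t‖ ≤ K * δ := by
  obtain ⟨hu0, hv0, U, U', V, V', hU, hV⟩ := isWeakSolution_iff.1 h
  obtain ⟨κ, _, ⟨R⟩⟩ := exists_eigenSystem_biharmonic
  -- The energy of the reference solution; the constant may depend on it, but not on `d'`. Below,
  -- `(α / 2)⁻¹` and `(1 / 3)⁻¹` are inverse coercivity constants, and `T` comes from integrating
  -- the uniform bound on `v' - v`.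
  set E := ∫ t in Ioo 0 T, ‖V t‖ ^ 2 with hE
  have hE0 : 0 ≤ E := integral_nonneg fun _ => sq_nonneg _
  set A := (α / 2)⁻¹ * E with hA
  have hA0 : 0 ≤ A := by positivity
  set B := (1 / 3 : ℝ)⁻¹ * (A * T) with hB
  have hB0 : 0 ≤ B := by positivity
  refine ⟨√(A + B), Real.sqrt_nonneg _, fun d' u' v' δ hd' h' hδ hdd => ?_⟩
  obtain ⟨ι, _, ⟨S⟩⟩ := exists_eigenSystem_diffusion hα hd'
  obtain ⟨hu0', hv0', U₁, U₁', V₁, V₁', hU₁, hV₁⟩ := isWeakSolution_iff.1 h'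
  -- `v` itself solves the problem with coefficient `d'` once the difference of the two forms is
  -- moved to the right-hand side.
  have hV₂ : IsSolution T (wderiv 0 : H10 →L[ℝ] L2Ω) (diffusionForm d')
      (fun t => pairing (wderiv 0) 0 + (diffusionForm d' (V t) - diffusionForm d (V t))) v V V' :=
    ⟨hV.continuousOn, hV.ae_eq, hV.inL2, hV.inL2', hV.weak, by
      filter_upwards [hV.eq] with t ht
      rw [← ht]
      abel⟩
  have hdiff : ∀ z : H10, ‖diffusionForm d' z - diffusionForm d z‖ ≤ δ * ‖z‖ := fun z => by
    refine ContinuousLinearMap.opNorm_le_bound _ (by positivity) fun φ => ?_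
    rw [sub_apply, diffusionForm_apply, diffusionForm_apply, ← inner_sub_left, ← mulOp_sub]
    refine (abs_real_inner_le_norm _ _).trans ?_
    refine mul_le_mul ((norm_mulOp_le hdd _).trans ?_) (norm_wderiv_le 1 φ) (norm_nonneg _)
      (by positivity)
    exact mul_le_mul_of_nonneg_left (norm_wderiv_le 1 z) hδ
  have hv : ∀ t ∈ Icc 0 T, ‖v' t - v t‖ ^ 2 ≤ A * δ ^ 2 := fun t ht => by
    have h1 := S.norm_sub_sq_le hT (diffusionForm_symm d') (by positivity)
      (diffusionForm_coercive hα hd') hV₁ hV₂ (hv0'.trans hv0.symm) ht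
    refine h1.trans ?_
    rw [hA, mul_assoc]
    refine mul_le_mul_of_nonneg_left ?_ (by positivity)
    rw [hE, mul_comm, ← integral_const_mul]
    refine integral_mono_of_nonneg (Eventually.of_forall fun _ => sq_nonneg _)
      (hV.inL2.integrable_norm_pow'.const_mul _) (Eventually.of_forall fun t => ?_)
    change ‖_‖ ^ 2 ≤ δ ^ 2 * ‖V t‖ ^ 2
    rw [sub_add_cancel_left, norm_neg (diffusionForm d' (V t) - diffusionForm d (V t)), ← mul_pow]
    exact pow_le_pow_left₀ (norm_nonneg (diffusionForm d' (V t) - diffusionForm d (V t)))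
      (hdiff (V t)) 2
  have hu : ∀ t ∈ Icc 0 T, ‖u' t - u t‖ ^ 2 ≤ B * δ ^ 2 := fun t ht => by
    have h1 := R.norm_sub_sq_le hT biharmonicForm_symm (by norm_num)
      biharmonicForm_coercive hU₁ hU (hu0'.trans hu0.symm) ht
    refine h1.trans ?_
    rw [hB, mul_assoc]
    refine mul_le_mul_of_nonneg_left ?_ (by norm_num)
    have h2 : ∫ _ in Ioo 0 T, A * δ ^ 2 = A * T * δ ^ 2 := by
      rw [setIntegral_const, Real.volume_real_Ioo_of_le hT.le, smul_eq_mul]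
      ring
    rw [← h2]
    refine integral_mono_of_nonneg (Eventually.of_forall fun _ => sq_nonneg _)
      (integrable_const _) ?_
    filter_upwards [ae_restrict_mem measurableSet_Ioo] with s hs
    have h3 : ‖pairing (wderiv 0 : V02 →L[ℝ] L2Ω) (v' s) - pairing (wderiv 0) (v s)‖ ≤
        ‖v' s - v s‖ := by
      rw [← pairing_sub]
      exact norm_pairing_wderiv_le _
    exact (pow_le_pow_left₀ (norm_nonneg (pairing (wderiv 0 : V02 →L[ℝ] L2Ω) (v' s) -
      pairing (wderiv 0) (v s))) h3 2).trans (hv s (Ioo_subset_Icc_self hs))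
  intro t ht
  have key : ∀ z : L2Ω, ‖z‖ ^ 2 ≤ (A + B) * δ ^ 2 → ‖z‖ ≤ √(A + B) * δ := fun z hz => by
    refine le_of_sq_le_sq ?_ (by positivity)
    rwa [mul_pow, Real.sq_sqrt (by positivity)]
  exact ⟨key _ ((hu t ht).trans (by gcongr; linarith)),
    key _ ((hv t ht).trans (by gcongr; linarith))⟩

/-- The Lipschitz estimate for equal coefficients, with `δ = 0`. -/
theorem IsWeakSolution.unique (hT : 0 < T) {d : H1} {α : ℝ} (hα : 0 < α)
    (hd : ∀ᵐ x ∂μΩ, α ≤ (wderiv 0 d : L2Ω) x) {u₀ v₀ : L2Ω} {u v u' v' : ℝ → L2Ω}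
    (h : IsWeakSolution T d u₀ v₀ u v) (h' : IsWeakSolution T d u₀ v₀ u' v') :
    EqOn u' u (Icc 0 T) ∧ EqOn v' v (Icc 0 T) := by
  obtain ⟨K, -, hK⟩ := h.exists_lipschitz hT hα
  have key := hK d u' v' 0 hd h' le_rfl (by
    rw [sub_self, map_zero]
    filter_upwards [Lp.coeFn_zero ℝ 2 μΩ] with x hx
    rw [hx, Pi.zero_apply, abs_zero])
  simp only [mul_zero] at key
  exact ⟨fun t ht => sub_eq_zero.1 (norm_le_zero_iff.1 (key t ht).1),
    fun t ht => sub_eq_zero.1 (norm_le_zero_iff.1 (key t ht).2)⟩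

/-- Parabolic smoothing: the final states are bounded in `V²₀ × H¹₀`, uniformly in the
coefficient. -/
theorem exists_bound_final (hT : 0 < T) {α : ℝ} (hα : 0 < α) (u₀ v₀ : L2Ω) :
    ∃ R, ∀ (d : H1) (u v : ℝ → L2Ω), (∀ᵐ x ∂μΩ, α ≤ (wderiv 0 d : L2Ω) x) →
      IsWeakSolution T d u₀ v₀ u v → ∃ (y : V02) (z : H10), (wderiv 0 y : L2Ω) = u T ∧
        (wderiv 0 z : L2Ω) = v T ∧ ‖y‖ ≤ R ∧ ‖z‖ ≤ R := by
  obtain ⟨κ, _, ⟨S'⟩⟩ := exists_eigenSystem_biharmonic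
  set A := (1 / 3 : ℝ)⁻¹ * (T⁻¹ * ‖u₀‖ ^ 2 + ‖v₀‖ ^ 2 * T) with hA
  set B := (α / 2)⁻¹ * (T⁻¹ * ‖v₀‖ ^ 2) with hB
  have hA0 : 0 ≤ A := by positivity
  have hB0 : 0 ≤ B := by positivity
  refine ⟨√(A + B), fun d u v hd h => ?_⟩
  obtain ⟨hu0, hv0, U, U', V, V', hU, hV⟩ := isWeakSolution_iff.1 h
  obtain ⟨ι, _, ⟨S⟩⟩ := exists_eigenSystem_diffusion hα hd
  have hvL : InL2 T v := memLp_of_continuousOn hV.continuousOn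
  obtain ⟨y, hy, hyb⟩ := S'.exists_lift_final hT biharmonicForm_symm (by norm_num)
    biharmonicForm_coercive hvL hU
  obtain ⟨z, hz, hzb⟩ := S.exists_lift_final hT (diffusionForm_symm d) (by positivity)
    (diffusionForm_coercive hα hd) (f := fun _ => 0) (by simp [InL2]) hV
  have hvI : ∫ s in Ioo 0 T, ‖v s‖ ^ 2 ≤ ‖v₀‖ ^ 2 * T := by
    have h2 : ∫ _ in Ioo 0 T, ‖v₀‖ ^ 2 = ‖v₀‖ ^ 2 * T := by
      rw [setIntegral_const, Real.volume_real_Ioo_of_le hT.le, smul_eq_mul]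
      ring
    rw [← h2]
    refine integral_mono_of_nonneg (Eventually.of_forall fun _ => sq_nonneg _)
      (integrable_const _) ?_
    filter_upwards [ae_restrict_mem measurableSet_Ioo] with s hs
    rw [← hv0]
    exact pow_le_pow_left₀ (norm_nonneg _)
      (S.norm_le_initial hT (diffusionForm_symm d) hV (Ioo_subset_Icc_self hs)) 2
  simp only [norm_zero, ne_eq, OfNat.ofNat_ne_zero, not_false_eq_true, zero_pow, integral_zero,
    add_zero] at hzb
  rw [hu0] at hyb
  rw [hv0] at hzb
  have hy2 : ‖y‖ ^ 2 ≤ A := by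
    rw [hA, inv_mul_eq_div, le_div_iff₀' (by norm_num)]
    linarith
  have hz2 : ‖z‖ ^ 2 ≤ B := by
    rw [hB, inv_mul_eq_div, le_div_iff₀' (by positivity)]
    exact hzb
  exact ⟨y, z, hy, hz, Real.le_sqrt_of_sq_le (by linarith), Real.le_sqrt_of_sq_le (by linarith)⟩

theorem V02.norm_toH10_le (z : V02) : ‖z.toH10‖ ≤ ‖z‖ := by
  refine le_of_sq_le_sq ?_ (norm_nonneg z)
  rw [norm_sq_eq_sum, norm_sq_eq_sum, Fin.sum_univ_two, Fin.sum_univ_three]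
  exact le_add_of_nonneg_right (sq_nonneg _)

/-! ### Boundedness and compactness of the input-output operator. -/

variable {α₀ α₁ α₂ : ℝ}

theorem admissible_ae_ge (d : admissible α₀ α₁ α₂) :
    ∀ᵐ x ∂μΩ, α₀ ≤ (wderiv 0 (d : H1) : L2Ω) x :=
  d.2.1.mono fun _ hx => hx.1

/-- Existence together with smoothing of `u(T)` into `H¹₀` provides a final state, so the choice in
`inputOutput` is a genuine one. -/
theorem exists_isWeakSolution_inputOutput (hT : 0 < T) (hα₀ : 0 < α₀) (u₀ v₀ : L2Ω)
    (d : admissible α₀ α₁ α₂) :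
    ∃ u v : ℝ → L2Ω, IsWeakSolution T d u₀ v₀ u v ∧
      embK (inputOutput T u₀ v₀ d) = (u T, v T) := by
  obtain ⟨u, v, h⟩ := exists_isWeakSolution hT hα₀ (admissible_ae_ge d) u₀ v₀
  obtain ⟨R, hR⟩ := exists_bound_final hT hα₀ u₀ v₀
  obtain ⟨y, -, hy, -⟩ := hR d u v (admissible_ae_ge d) h
  exact Classical.epsilon_spec (p := IsFinalState T u₀ v₀ d)
    ⟨(y.toH10, v T), u, v, h, Prod.ext hy rfl⟩

theorem exists_bound_inputOutput (hT : 0 < T) (hα₀ : 0 < α₀) (u₀ v₀ : L2Ω) :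
    ∃ R, ∀ d : admissible α₀ α₁ α₂, ∃ (y : V02) (z : H10),
      inputOutput T u₀ v₀ d = (y.toH10, wderiv 0 z) ∧ ‖y‖ ≤ R ∧ ‖z‖ ≤ R := by
  obtain ⟨R, hR⟩ := exists_bound_final hT hα₀ u₀ v₀
  refine ⟨R, fun d => ?_⟩
  obtain ⟨u, v, h, hk⟩ := exists_isWeakSolution_inputOutput hT hα₀ u₀ v₀ d
  obtain ⟨y, z, hy, hz, hyR, hzR⟩ := hR d u v (admissible_ae_ge d) h
  refine ⟨y, z, Prod.ext (wderiv_zero_injective ?_) ?_, hyR, hzR⟩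
  · exact (congrArg Prod.fst hk).trans hy.symm
  · exact (congrArg Prod.snd hk).trans hz.symm

/-- Serves twice: with `δ = 3 ‖d' - d‖` it gives continuity on `𝒟`, and with `δ` the size of the
oscillations it gives instability. -/
theorem exists_lipschitz_inputOutput (hT : 0 < T) (hα₀ : 0 < α₀) (u₀ v₀ : L2Ω)
    (d : admissible α₀ α₁ α₂) :
    ∃ K, 0 ≤ K ∧ ∀ (d' : admissible α₀ α₁ α₂) (δ : ℝ), 0 ≤ δ →
      (∀ᵐ x ∂μΩ, |(wderiv 0 ((d' : H1) - (d : H1)) : L2Ω) x| ≤ δ) →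
      dist (embK (inputOutput T u₀ v₀ d')) (embK (inputOutput T u₀ v₀ d)) ≤ K * δ := by
  obtain ⟨u, v, h, hk⟩ := exists_isWeakSolution_inputOutput hT hα₀ u₀ v₀ d
  obtain ⟨K, hK0, hK⟩ := h.exists_lipschitz hT hα₀
  refine ⟨K, hK0, fun d' δ hδ hdd => ?_⟩
  obtain ⟨u', v', h', hk'⟩ := exists_isWeakSolution_inputOutput hT hα₀ u₀ v₀ d'
  obtain ⟨h1, h2⟩ := hK d' u' v' δ (admissible_ae_ge d') h' hδ hdd T (right_mem_Icc.2 hT.le)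
  rw [hk, hk', Prod.dist_eq, dist_eq_norm, dist_eq_norm]
  exact max_le h1 h2

theorem isBounded_image_inputOutput (hT : 0 < T) (hα₀ : 0 < α₀) (u₀ v₀ : L2Ω)
    (B : Set (admissible α₀ α₁ α₂)) : Bornology.IsBounded (inputOutput T u₀ v₀ '' B) := by
  obtain ⟨R, hR⟩ := exists_bound_inputOutput (α₁ := α₁) (α₂ := α₂) hT hα₀ u₀ v₀
  refine (isBounded_iff_forall_norm_le).2 ⟨R, ?_⟩
  rintro _ ⟨d, -, rfl⟩
  obtain ⟨y, z, h, hy, hz⟩ := hR d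
  rw [h]
  exact max_le (y.norm_toH10_le.trans hy) ((norm_wderiv_le 0 z).trans hz)

/-- The image lies in the product of the images in `L²` of balls of `V²₀` and `H¹₀`, both relatively
compact. The radius does not depend on the set of coefficients. -/
theorem isCompactMap_inputOutput (hT : 0 < T) (hα₀ : 0 < α₀) (u₀ v₀ : L2Ω) :
    IsCompactMap fun d : admissible α₀ α₁ α₂ => embK (inputOutput T u₀ v₀ d) := by
  refine ⟨continuous_iff_continuousAt.2 fun d => ?_, fun B _ => ?_⟩
  · obtain ⟨K, hK0, hK⟩ := exists_lipschitz_inputOutput hT hα₀ u₀ v₀ d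
    rw [ContinuousAt, tendsto_iff_dist_tendsto_zero]
    refine squeeze_zero (fun _ => dist_nonneg)
      (fun d' => hK d' (3 * ‖(d' : H1) - (d : H1)‖) (by positivity) (H1.ae_abs_le _)) ?_
    have h1 : Continuous fun d' : admissible α₀ α₁ α₂ => K * (3 * ‖(d' : H1) - (d : H1)‖) := by
      fun_prop
    simpa using h1.tendsto d
  · obtain ⟨R, hR⟩ := exists_bound_inputOutput (α₁ := α₁) (α₂ := α₂) hT hα₀ u₀ v₀
    have h1 := (isCompactOperator_wderiv_zero (n := 1)).isCompact_closure_image_closedBall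
      (f := (wderiv 0 : V02 →L[ℝ] L2Ω).toLinearMap) R
    have h2 := (isCompactOperator_wderiv_zero (n := 0)).isCompact_closure_image_closedBall
      (f := (wderiv 0 : H10 →L[ℝ] L2Ω).toLinearMap) R
    refine (h1.prod h2).of_isClosed_subset isClosed_closure ?_
    rw [← closure_prod_eq]
    refine closure_mono ?_
    rintro _ ⟨d, -, rfl⟩
    obtain ⟨y, z, h, hy, hz⟩ := hR d
    simp only [h]
    exact ⟨⟨y, mem_closedBall_zero_iff.2 hy, rfl⟩, ⟨z, mem_closedBall_zero_iff.2 hz, rfl⟩⟩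

end Cascade

/-! ### Oscillating coefficients and ill-posedness. -/

section Instability

theorem memLp_of_hasDerivAt {φ φ' : ℝ → ℝ} (hd : ∀ x, HasDerivAt φ (φ' x) x) : MemLp φ 2 μΩ :=
  memLp_of_continuousOn fun x _ => (hd x).continuousAt.continuousWithinAt

/-- A continuously differentiable function as an element of `H¹(Ω)`. -/
def smoothH1 {φ φ' : ℝ → ℝ} (hd : ∀ x, HasDerivAt φ (φ' x) x) (hc : Continuous φ') : H1 :=
  ⟨WithLp.toLp 2 ![((memLp_of_hasDerivAt hd).toLp : L2Ω),
    ((memLp_of_continuousOn hc.continuousOn).toLp : L2Ω)], fun i => by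
    fin_cases i
    exact hasWeakDeriv_toLp hd hc (memLp_of_hasDerivAt hd)
      (memLp_of_continuousOn hc.continuousOn)⟩

theorem coeFn_smoothH1 {φ φ' : ℝ → ℝ} (hd : ∀ x, HasDerivAt φ (φ' x) x) (hc : Continuous φ') :
    ∀ᵐ x ∂μΩ, (wderiv 0 (smoothH1 hd hc) : L2Ω) x = φ x :=
  (memLp_of_hasDerivAt hd).coeFn_toLp

theorem coeFn_deriv_smoothH1 {φ φ' : ℝ → ℝ} (hd : ∀ x, HasDerivAt φ (φ' x) x)
    (hc : Continuous φ') : ∀ᵐ x ∂μΩ, (wderiv 1 (smoothH1 hd hc) : L2Ω) x = φ' x :=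
  (memLp_of_continuousOn hc.continuousOn).coeFn_toLp

theorem integral_cos_sq_eq {k : ℝ} (hk : k ≠ 0) (hs : Real.sin k = 0) :
    ∫ x in Ioo (0 : ℝ) 1, Real.cos (k * x) ^ 2 = 1 / 2 := by
  have hd : ∀ x, HasDerivAt (fun x => x / 2 + Real.sin (k * x) * Real.cos (k * x) / (2 * k))
      (Real.cos (k * x) ^ 2) x := fun x => by
    have h1 : HasDerivAt (fun x => k * x) k x := by simpa using (hasDerivAt_id x).const_mul k
    refine (((hasDerivAt_id x).div_const 2).add
      (((h1.sin).mul (h1.cos)).div_const (2 * k))).congr_deriv ?_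
    have := Real.sin_sq_add_cos_sq (k * x)
    field_simp
    linarith
  rw [integral_Ioo_eq_intervalIntegral zero_le_one,
    intervalIntegral.integral_eq_sub_of_hasDerivAt (fun x _ => hd x)
      ((by fun_prop : Continuous fun x => Real.cos (k * x) ^ 2).intervalIntegrable 0 1)]
  simp [hs]

/-- Functions that tend to `0` uniformly, but not in `H¹(Ω)`. -/
theorem exists_oscillating : ∃ e : ℕ → H1, ∀ n,
    (∀ᵐ x ∂μΩ, |(wderiv 0 (e n) : L2Ω) x| ≤ 1 / ((n : ℝ) + 1)) ∧ ‖e n‖ ≤ 1 + Real.pi ∧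
      1 ≤ ‖e n‖ := by
  have hk : ∀ n : ℕ, (0 : ℝ) < ((n : ℝ) + 1) * Real.pi := fun n => by positivity
  have hd : ∀ (n : ℕ) (x : ℝ), HasDerivAt
      (fun x => Real.sin (((n : ℝ) + 1) * Real.pi * x) / ((n : ℝ) + 1))
      (Real.pi * Real.cos (((n : ℝ) + 1) * Real.pi * x)) x := fun n x => by
    have h1 : HasDerivAt (fun x => ((n : ℝ) + 1) * Real.pi * x) (((n : ℝ) + 1) * Real.pi) x := by
      simpa using (hasDerivAt_id x).const_mul (((n : ℝ) + 1) * Real.pi)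
    refine (h1.sin.div_const ((n : ℝ) + 1)).congr_deriv ?_
    have : (n : ℝ) + 1 ≠ 0 := by positivity
    field_simp
  have hc : ∀ n : ℕ, Continuous fun x => Real.pi * Real.cos (((n : ℝ) + 1) * Real.pi * x) :=
    fun n => by fun_prop
  -- The functions `sin((n+1)πx)/(n+1)`: the amplitude decays while the derivative `π cos((n+1)πx)`
  -- keeps squared norm `π²/2`.
  refine ⟨fun n => smoothH1 (hd n) (hc n), fun n => ?_⟩
  have h0 : ∀ᵐ x ∂μΩ, |(wderiv 0 (smoothH1 (hd n) (hc n)) : L2Ω) x| ≤ 1 / ((n : ℝ) + 1) := by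
    filter_upwards [coeFn_smoothH1 (hd n) (hc n)] with x hx
    rw [hx, abs_div, abs_of_pos (by positivity : (0 : ℝ) < (n : ℝ) + 1)]
    gcongr
    exact Real.abs_sin_le_one _
  have h1 : ‖(wderiv 1 (smoothH1 (hd n) (hc n)) : L2Ω)‖ ^ 2 = Real.pi ^ 2 / 2 := by
    have hs : Real.sin (((n : ℝ) + 1) * Real.pi) = 0 := by
      have := Real.sin_nat_mul_pi (n + 1)
      push_cast at this
      exact this
    rw [norm_sq_eq_integral]
    calc _ = ∫ x in Ioo (0 : ℝ) 1, Real.pi ^ 2 * Real.cos (((n : ℝ) + 1) * Real.pi * x) ^ 2 := by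
          refine integral_congr_ae ?_
          filter_upwards [coeFn_deriv_smoothH1 (hd n) (hc n)] with x hx
          rw [hx, mul_pow]
      _ = _ := by
          rw [integral_const_mul, integral_cos_sq_eq (hk n).ne' hs]
          ring
  have hpi := Real.pi_gt_three
  have h2 : ‖(wderiv 0 (smoothH1 (hd n) (hc n)) : L2Ω)‖ ≤ 1 :=
    (norm_le_of_ae_abs_le (by positivity) h0).trans
      (div_le_one_of_le₀ (by linarith [(n.cast_nonneg : (0 : ℝ) ≤ n)]) (by positivity))
  have h3 := norm_sq_eq_sum (smoothH1 (hd n) (hc n))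
  rw [Fin.sum_univ_two, h1] at h3
  have h4 := pow_le_one₀ (n := 2) (norm_nonneg _) h2
  refine ⟨h0, le_of_sq_le_sq ?_ (by positivity), le_of_sq_le_sq ?_ (norm_nonneg _)⟩
  · nlinarith
  · nlinarith [sq_nonneg ‖(wderiv 0 (smoothH1 (hd n) (hc n)) : L2Ω)‖]

/-- A constant coefficient inside the admissible range is perturbed by `ε e_n`: the data differ by
`O(1/(n+1))`, the coefficients by at least `ε` in `H¹`. -/
theorem isUnstable_inputOutput {T α₀ α₁ α₂ : ℝ} (hT : 0 < T) (hα₀ : 0 < α₀) (h₁ : α₀ < α₁)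
    (h₂ : α₀ < α₂) (u₀ v₀ : L2Ω) :
    IsUnstable fun d : admissible α₀ α₁ α₂ => embK (inputOutput T u₀ v₀ d) := by
  obtain ⟨e, he⟩ := exists_oscillating
  set m := min α₁ α₂ with hm
  have hm0 : α₀ < m := lt_min h₁ h₂
  have hpi := Real.pi_pos
  -- The constant lies midway between `α₀` and `m`, and its `H¹` norm is at most `c` since `Ω` has
  -- measure one. `ε` is such that `ε e_n` has norm, and hence also supremum, at most `(m - α₀)/2`,
  -- keeping the perturbed coefficients admissible.
  set c := (α₀ + m) / 2 with hc
  set ε := (m - α₀) / (2 * (1 + Real.pi)) with hε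
  have hε0 : 0 < ε := div_pos (sub_pos.2 hm0) (by positivity)
  have hε1 : ε * (1 + Real.pi) = (m - α₀) / 2 := by
    rw [hε]
    field_simp
  have hε2 : ε ≤ (m - α₀) / 2 := by nlinarith
  have hm1 : m ≤ α₁ := min_le_left _ _
  have hm2 : m ≤ α₂ := min_le_right _ _
  set C : H1 := smoothH1 (fun x => hasDerivAt_const x c) continuous_const with hC
  have hCae : ∀ᵐ x ∂μΩ, (wderiv 0 C : L2Ω) x = c := coeFn_smoothH1 _ _
  have hCn : ‖C‖ ≤ c := by
    have hc0 : 0 ≤ c := by rw [hc]; linarith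
    refine le_of_sq_le_sq ?_ hc0
    have h1 : ‖(wderiv 0 C : L2Ω)‖ ≤ c := norm_le_of_ae_abs_le hc0 (by
      filter_upwards [hCae] with x hx
      rw [hx, abs_of_nonneg hc0])
    have h2 : ‖(wderiv 1 C : L2Ω)‖ ≤ 0 := norm_le_of_ae_abs_le le_rfl (by
      filter_upwards [coeFn_deriv_smoothH1 (fun x => hasDerivAt_const x c) continuous_const]
        with x hx
      rw [hx, abs_zero])
    rw [norm_sq_eq_sum, Fin.sum_univ_two, norm_le_zero_iff.1 h2]
    simpa using pow_le_pow_left₀ (norm_nonneg _) h1 2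
  have hpert : ∀ n, ∀ᵐ x ∂μΩ, |(wderiv 0 (ε • e n) : L2Ω) x| ≤
      ε * (1 / ((n : ℝ) + 1)) := fun n => by
    rw [map_smul]
    filter_upwards [(he n).1, Lp.coeFn_smul ε (wderiv 0 (e n) : L2Ω)] with x h1 h2
    rw [h2, Pi.smul_apply, smul_eq_mul, abs_mul, abs_of_pos hε0]
    gcongr
  have hsmall : ∀ n : ℕ, ε * (1 / ((n : ℝ) + 1)) ≤ ε := fun n =>
    mul_le_of_le_one_right hε0.le
      (div_le_one_of_le₀ (by linarith [(n.cast_nonneg : (0 : ℝ) ≤ n)]) (by positivity))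
  have hCmem : C ∈ admissible α₀ α₁ α₂ := by
    refine ⟨?_, hCn.trans (by rw [hc]; linarith)⟩
    filter_upwards [hCae] with x hx
    rw [hx, hc]
    constructor <;> linarith
  have hsmem : ∀ n, C + ε • e n ∈ admissible α₀ α₁ α₂ := fun n => by
    refine ⟨?_, ?_⟩
    · rw [map_add]
      filter_upwards [hCae, hpert n, Lp.coeFn_add (wderiv 0 C : L2Ω) (wderiv 0 (ε • e n))]
        with x h1 h2 h3
      rw [h3, Pi.add_apply, h1]
      have h4 := abs_le.1 (h2.trans (hsmall n))
      constructor <;> linarith [h4.1, h4.2]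
    · refine (norm_add_le _ _).trans ?_
      rw [norm_smul, Real.norm_of_nonneg hε0.le]
      have := mul_le_mul_of_nonneg_left (he n).2.1 hε0.le
      linarith
  refine ⟨⟨C, hCmem⟩, fun n => ⟨C + ε • e n, hsmem n⟩, ?_, fun hlim => ?_⟩
  · obtain ⟨K, -, hK⟩ := exists_lipschitz_inputOutput hT hα₀ u₀ v₀ ⟨C, hCmem⟩
    rw [tendsto_iff_dist_tendsto_zero]
    refine squeeze_zero (fun _ => dist_nonneg)
      (fun n => hK ⟨C + ε • e n, hsmem n⟩ (ε * (1 / ((n : ℝ) + 1))) (by positivity) ?_) ?_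
    · simpa using hpert n
    · simpa using (tendsto_one_div_add_atTop_nhds_zero_nat (𝕜 := ℝ)).const_mul ε |>.const_mul K
  · rw [tendsto_iff_dist_tendsto_zero] at hlim
    obtain ⟨n, hn⟩ := (hlim.eventually_lt_const hε0).exists
    rw [Subtype.dist_eq, dist_eq_norm, add_sub_cancel_left, norm_smul,
      Real.norm_of_nonneg hε0.le] at hn
    nlinarith [(he n).2.2]

end Instability

end CascadeInverse

end

theorem mainTheorem7 (T α₀ α₁ α₂ : ℝ) (hT : 0 < T) (hα₀ : 0 < α₀) (u₀ : H2) (v₀ : H10)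
    (Ψ : admissible α₀ α₁ α₂ → H10 × L2Ω)
    (hΨ : Ψ = inputOutput T (wderiv 0 u₀) (wderiv 0 v₀)) :
    -- `Ψ` is well defined: there is exactly one weak solution, and `Ψ[d]` is its final state
    (∀ d : admissible α₀ α₁ α₂, ∃ u v : ℝ → L2Ω,
      IsWeakSolution T d (wderiv 0 u₀) (wderiv 0 v₀) u v ∧
      (∀ u' v' : ℝ → L2Ω, IsWeakSolution T d (wderiv 0 u₀) (wderiv 0 v₀) u' v' →
        EqOn u' u (Icc 0 T) ∧ EqOn v' v (Icc 0 T)) ∧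
      embK (Ψ d) = (u T, v T)) ∧
    -- `Ψ` maps bounded sets of coefficients to bounded sets of `H¹₀ × L²`
    (∀ B : Set (admissible α₀ α₁ α₂), Bornology.IsBounded B → Bornology.IsBounded (Ψ '' B)) ∧
    -- `Ψ` is compact into `L² × L²`
    IsCompactMap (fun d => embK (Ψ d)) ∧
    -- the inverse problem is ill-posed, as soon as there is more than one admissible coefficient
    (α₀ < α₁ → α₀ < α₂ → IsUnstable (fun d => embK (Ψ d))) := by
  subst hΨ
  refine ⟨fun d => ?_, fun B _ => isBounded_image_inputOutput hT hα₀ _ _ B,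
    isCompactMap_inputOutput hT hα₀ _ _, fun h₁ h₂ => isUnstable_inputOutput hT hα₀ h₁ h₂ _ _⟩
  obtain ⟨u, v, h, hk⟩ := exists_isWeakSolution_inputOutput hT hα₀ (wderiv 0 u₀) (wderiv 0 v₀) d
  exact ⟨u, v, h, fun u' v' h' => h.unique hT hα₀ (admissible_ae_ge d) h', hk⟩
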